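/- Let $R$ be a principal ideal domain, $G$ an $R$-module and $0\to G\xrightarrow{\alpha} G'\xrightarrow{\beta} G''\to 0$ an injective resolution of $G$ (a short exact sequence with $G'$, $G''$ injective). For a cochain complex $C^*$ of $R$-modules (graded by $\mathbb Z$, not necessarily free) let $\bar H_n(C^*;G)$ be the $n$-th homology of the chain complex with $n$-th module $\operatorname{Hom}(C^n,G')\oplus\operatorname{Hom}(C^{n+1},G'')$ and boundary $\partial(\varphi',\varphi'')=(\varphi'\circ\delta,\ \beta\circ\varphi'-\varphi''\circ\delta)$; it is a contravariant functor of $C^*$. Let $\bar\xi:\bar H_n(C^*;G)\to\operatorname{Hom}(H^n(C^*),G)$ be the homomorphism with $\alpha(\bar\xi[(\varphi',\varphi'')]([c]))=\varphi'(c)$ for every cocycle $c\in C^n$, and let $\bar\chi:\operatorname{Ext}(H^{n+1}(C^*),G)\to\bar H_n(C^*;G)$ be the homomorphism that sends the image of $\bar\varphi''\in\operatorname{Hom}(H^{n+1}(C^*),G'')$ under the connecting homomorphism $\operatorname{Hom}(H^{n+1}(C^*),G'')\to\operatorname{Ext}(H^{n+1}(C^*),G)$ to the class of $(0,-\varphi'')$,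 where $\varphi'':C^{n+1}\to G''$ is any homomorphism whose restriction to cocycles is $c\mapsto\bar\varphi''([c])$. Both are well defined and natural in $C^*$. Let $\varprojlim^{(i)}$ denote the $i$-th right derived functor of the inverse limit functor on inverse systems of $R$-modules over a (nonempty) directed set $\Gamma$. Then for all integers $n$ and $i\ge 0$ and every direct system $\{C^*_\gamma\}_{\gamma\in\Gamma}$ of cochain complexes of $R$-modules, the sequence $$0\to\varprojlim\nolimits^{(i)}\operatorname{Ext}(H^{n+1}(C^*_\gamma),G)\xrightarrow{\varprojlim^{(i)}\bar\chi_\gamma}\varprojlim\nolimits^{(i)}\bar H_n(C^*_\gamma;G)\xrightarrow{\varprojlim^{(i)}\bar\xi_\gamma}\varprojlim\nolimits^{(i)}\operatorname{Hom}(H^n(C^*_\gamma),G)\to 0$$ is exact. For $i\ge 1$ it splits naturally: the splittings can be chosen for all direct systems over $\Gamma$ simultaneously so that they commute with the maps induced by morphisms of direct systems. -/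

import Mathlib

open CategoryTheory Limits Opposite

universe u

noncomputable section

namespace UCF

section DerivedLimits

variable (R : Type u) [CommRing R] (Γ : Type u) [Preorder Γ]

/-- Inverse systems of `R`-modules indexed by `Γ` form a category with enough injectives, so that
right derived functors of `lim` exist on it. -/
instance hasInjectiveResolutions_inverseSystem :
    HasInjectiveResolutions (Γᵒᵖ ⥤ ModuleCat.{u} R) :=
  have : IsGrothendieckAbelian.{u} (Γᵒᵖ ⥤ ModuleCat.{u} R) :=
    IsGrothendieckAbelian.of_equivalence (sheafBotEquivalence (C := Γ) (ModuleCat.{u} R))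
  inferInstance

instance additive_lim : (lim : (Γᵒᵖ ⥤ ModuleCat.{u} R) ⥤ ModuleCat.{u} R).Additive :=
  Functor.additive_of_preserves_binary_products _

/-- `lim^(i)`, the `i`-th right derived functor of the inverse limit functor on inverse systems
of `R`-modules indexed by `Γ`. -/
abbrev limD (i : ℕ) : (Γᵒᵖ ⥤ ModuleCat.{u} R) ⥤ ModuleCat.{u} R :=
  (lim : (Γᵒᵖ ⥤ ModuleCat.{u} R) ⥤ ModuleCat.{u} R).rightDerived i

instance preservesZeroMorphisms_limD (i : ℕ) : (limD R Γ i).PreservesZeroMorphisms where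
  map_zero X Y := by
    rw [Functor.rightDerived_map_eq _ i (0 : X ⟶ Y)
      (P := injectiveResolution X) (Q := injectiveResolution Y) 0 (by simp)]
    simp
    exact zero_comp

end DerivedLimits

variable {R : Type u} [CommRing R]

/-- The contravariant functor `M ↦ Hom(M, G)`. -/
abbrev homInto (G : ModuleCat.{u} R) : (ModuleCat.{u} R)ᵒᵖ ⥤ ModuleCat.{u} R :=
  (linearYoneda R (ModuleCat.{u} R)).obj G

/-- The contravariant functor `M ↦ Ext¹(M, G)`. -/
@[simps]
def extInto (G : ModuleCat.{u} R) : (ModuleCat.{u} R)ᵒᵖ ⥤ ModuleCat.{u} R where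
  obj M := ModuleCat.of R (Abelian.Ext.{u} M.unop G 1)
  map f := ModuleCat.ofHom
    (Abelian.Ext.precompOfLinear (Abelian.Ext.mk₀ f.unop) R G (zero_add 1))
  map_id M := by ext x; simp
  map_comp f g := by
    ext x
    exact Abelian.Ext.mk₀_comp_mk₀_assoc _ _ _ |>.symm

/-- The connecting homomorphism `Hom(M, G'') → Ext¹(M, G)` of a short exact sequence
`0 → G → G' → G'' → 0`. -/
def connecting {S : ShortComplex (ModuleCat.{u} R)} (hS : S.ShortExact) (M : ModuleCat.{u} R) :
    (M ⟶ S.X₃) →ₗ[R] Abelian.Ext.{u} M S.X₁ 1 :=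
  Abelian.Ext.postcompOfLinear hS.extClass R M (zero_add 1) ∘ₗ
    (Abelian.Ext.linearEquiv₀ (R := R)).symm.toLinearMap

lemma connecting_apply {S : ShortComplex (ModuleCat.{u} R)} (hS : S.ShortExact)
    (M : ModuleCat.{u} R) (f : M ⟶ S.X₃) :
    connecting hS M f = (Abelian.Ext.mk₀ f).comp hS.extClass (zero_add 1) := by
  simp [connecting]

lemma connecting_surjective {S : ShortComplex (ModuleCat.{u} R)} (hS : S.ShortExact)
    [Injective S.X₂] (M : ModuleCat.{u} R) : Function.Surjective (connecting hS M) := by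
  intro x
  obtain ⟨y, hy⟩ := Abelian.Ext.covariant_sequence_exact₁ (hS := hS) M x
    (Abelian.Ext.eq_zero_of_injective _) (zero_add 1)
  obtain ⟨f, rfl⟩ := (Abelian.Ext.linearEquiv₀ (R := R)).symm.surjective y
  exact ⟨f, by rw [connecting_apply]; simpa using hy⟩

lemma exists_of_connecting_eq_zero {S : ShortComplex (ModuleCat.{u} R)} (hS : S.ShortExact)
    (M : ModuleCat.{u} R) (f : M ⟶ S.X₃) (h : connecting hS M f = 0) :
    ∃ g : M ⟶ S.X₂, g ≫ S.g = f := by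
  rw [connecting_apply] at h
  obtain ⟨y, hy⟩ := Abelian.Ext.covariant_sequence_exact₃ (hS := hS) M _ (zero_add 1) h
  obtain ⟨g, rfl⟩ := (Abelian.Ext.linearEquiv₀ (R := R)).symm.surjective y
  refine ⟨g, (Abelian.Ext.linearEquiv₀ (R := R)).symm.injective ?_⟩
  simpa using hy

lemma connecting_naturality {S : ShortComplex (ModuleCat.{u} R)} (hS : S.ShortExact)
    {M N : ModuleCat.{u} R} (a : M ⟶ N) (f : N ⟶ S.X₃) :
    connecting hS M (a ≫ f) =
      (Abelian.Ext.mk₀ a).comp (connecting hS N f) (zero_add 1) := by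
  rw [connecting_apply, connecting_apply]
  exact (Abelian.Ext.mk₀_comp_mk₀_assoc _ _ _).symm

/-- Cochain complexes `C^*` of `R`-modules, graded by the integers. -/
abbrev Cochains (R : Type u) [CommRing R] := CochainComplex (ModuleCat.{u} R) ℤ

section Cone

variable (S : ShortComplex (ModuleCat.{u} R)) (C : Cochains R)

/-- The boundary `∂(φ', φ'') = (φ' ∘ δ, β ∘ φ' - φ'' ∘ δ)` from
`Hom(C^j, G') ⊕ Hom(C^k, G'')` to `Hom(C^i, G') ⊕ Hom(C^j, G'')`. For `S` a sequence
`G → G' → G''` with second map `β`, the cone `C_*(β_#)` has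
`C_n(β_#) = Hom(C^n, G') ⊕ Hom(C^(n+1), G'')`, and its boundary `C_n(β_#) → C_(n-1)(β_#)` is the
case `(i, j, k) = (n - 1, n, n + 1)`. -/
def boundary (i j k : ℤ) :
    ((C.X j ⟶ S.X₂) × (C.X k ⟶ S.X₃)) →ₗ[R] ((C.X i ⟶ S.X₂) × (C.X j ⟶ S.X₃)) where
  toFun φ := (C.d i j ≫ φ.1, φ.1 ≫ S.g - C.d j k ≫ φ.2)
  map_add' φ ψ := by
    ext1 <;> simp [Preadditive.add_comp, Preadditive.comp_add]
    abel
  map_smul' r φ := by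
    ext1 <;> simp [smul_sub]

@[simp]
lemma boundary_apply (i j k : ℤ) (φ : (C.X j ⟶ S.X₂) × (C.X k ⟶ S.X₃)) :
    boundary S C i j k φ = (C.d i j ≫ φ.1, φ.1 ≫ S.g - C.d j k ≫ φ.2) := rfl

lemma boundary_boundary (h i j k : ℤ) (φ : (C.X j ⟶ S.X₂) × (C.X k ⟶ S.X₃)) :
    boundary S C h i j (boundary S C i j k φ) = 0 := by
  ext1 <;> simp [Preadditive.comp_sub]

/-- The cycles `Z_n` of the cone `C_*(β_#)`. -/
abbrev coneCycles (n : ℤ) : Submodule R ((C.X n ⟶ S.X₂) × (C.X (n + 1) ⟶ S.X₃)) :=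
  LinearMap.ker (boundary S C (n - 1) n (n + 1))

/-- The boundaries `B_n` of the cone `C_*(β_#)`. -/
abbrev coneBoundaries (n : ℤ) : Submodule R ((C.X n ⟶ S.X₂) × (C.X (n + 1) ⟶ S.X₃)) :=
  LinearMap.range (boundary S C n (n + 1) (n + 2))

/-- The homology `H̄_n(C^*; G) = Z_n / B_n` of the cone `C_*(β_#)`. -/
abbrev coneHomology (n : ℤ) : Type u :=
  coneCycles S C n ⧸ (coneBoundaries S C n).submoduleOf (coneCycles S C n)

/-- The homology class of a cycle. -/
abbrev coneClass (n : ℤ) : coneCycles S C n →ₗ[R] coneHomology S C n :=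
  ((coneBoundaries S C n).submoduleOf (coneCycles S C n)).mkQ

variable {S C}

lemma coneCycles_fst {n : ℤ} (z : coneCycles S C n) : C.d (n - 1) n ≫ z.1.1 = 0 :=
  congr_arg Prod.fst (LinearMap.mem_ker.1 z.2)

lemma coneCycles_snd {n : ℤ} (z : coneCycles S C n) :
    z.1.1 ≫ S.g = C.d n (n + 1) ≫ z.1.2 :=
  sub_eq_zero.1 (congr_arg Prod.snd (LinearMap.mem_ker.1 z.2))

lemma coneClass_eq_iff {n : ℤ} (z w : coneCycles S C n) :
    coneClass S C n z = coneClass S C n w ↔ z.1 - w.1 ∈ coneBoundaries S C n := by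
  exact Submodule.Quotient.eq _

/-- The map `(φ', φ'') ↦ (φ' ∘ f, φ'' ∘ f)` induced by a cochain map `f`. -/
def coneMap (S : ShortComplex (ModuleCat.{u} R)) {C D : Cochains R} (f : C ⟶ D) (j k : ℤ) :
    ((D.X j ⟶ S.X₂) × (D.X k ⟶ S.X₃)) →ₗ[R] ((C.X j ⟶ S.X₂) × (C.X k ⟶ S.X₃)) :=
  LinearMap.prodMap (Linear.leftComp R S.X₂ (f.f j)) (Linear.leftComp R S.X₃ (f.f k))

@[simp]
lemma coneMap_apply {C D : Cochains R} (f : C ⟶ D) (j k : ℤ)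
    (φ : (D.X j ⟶ S.X₂) × (D.X k ⟶ S.X₃)) :
    coneMap S f j k φ = (f.f j ≫ φ.1, f.f k ≫ φ.2) := rfl

lemma boundary_coneMap {C D : Cochains R} (f : C ⟶ D) (i j k : ℤ)
    (φ : (D.X j ⟶ S.X₂) × (D.X k ⟶ S.X₃)) :
    boundary S C i j k (coneMap S f j k φ) = coneMap S f i j (boundary S D i j k φ) := by
  ext1 <;> simp [Preadditive.comp_sub]

/-- The map induced by a cochain map on cycles of the cones. -/
def coneCyclesMap (S : ShortComplex (ModuleCat.{u} R)) {C D : Cochains R} (f : C ⟶ D) (n : ℤ) :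
    coneCycles S D n →ₗ[R] coneCycles S C n :=
  (coneMap S f n (n + 1)).restrict fun φ hφ => by
    rw [LinearMap.mem_ker] at hφ ⊢
    rw [boundary_coneMap, hφ, map_zero]

/-- The map induced by a cochain map on homology of the cones. -/
def coneHomologyMap (S : ShortComplex (ModuleCat.{u} R)) {C D : Cochains R} (f : C ⟶ D) (n : ℤ) :
    coneHomology S D n →ₗ[R] coneHomology S C n :=
  Submodule.mapQ _ _ (coneCyclesMap S f n) (by
    rintro z ⟨ψ, hψ⟩
    exact ⟨coneMap S f (n + 1) (n + 2) ψ, by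
      rw [boundary_coneMap, hψ]; rfl⟩)

@[simp]
lemma coneHomologyMap_class {C D : Cochains R} (f : C ⟶ D) (n : ℤ) (z : coneCycles S D n) :
    coneHomologyMap S f n (coneClass S D n z) = coneClass S C n (coneCyclesMap S f n z) := rfl

end Cone

/-- The contravariant functor `C^* ↦ H̄_n(C^*; G)`. -/
def Hbar (S : ShortComplex (ModuleCat.{u} R)) (n : ℤ) : (Cochains R)ᵒᵖ ⥤ ModuleCat.{u} R where
  obj C := ModuleCat.of R (coneHomology S C.unop n)
  map f := ModuleCat.ofHom (coneHomologyMap S f.unop n)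
  map_id C := by
    refine ModuleCat.hom_ext (LinearMap.ext fun x => ?_)
    obtain ⟨z, rfl⟩ := Submodule.mkQ_surjective _ x
    refine congr_arg (coneClass S C.unop n) (Subtype.ext ?_)
    simp [coneCyclesMap]
  map_comp f g := by
    refine ModuleCat.hom_ext (LinearMap.ext fun x => ?_)
    obtain ⟨z, rfl⟩ := Submodule.mkQ_surjective _ x
    refine congr_arg (coneClass S _ n) (Subtype.ext ?_)
    simp [coneCyclesMap]

/-- The contravariant functor `C^* ↦ Hom(H^n(C^*), G)`. -/
abbrev homH (G : ModuleCat.{u} R) (n : ℤ) : (Cochains R)ᵒᵖ ⥤ ModuleCat.{u} R :=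
  (HomologicalComplex.homologyFunctor (ModuleCat.{u} R) (ComplexShape.up ℤ) n).op ⋙ homInto G

/-- The contravariant functor `C^* ↦ Ext¹(H^n(C^*), G)`. -/
abbrev extH (G : ModuleCat.{u} R) (n : ℤ) : (Cochains R)ᵒᵖ ⥤ ModuleCat.{u} R :=
  (HomologicalComplex.homologyFunctor (ModuleCat.{u} R) (ComplexShape.up ℤ) n).op ⋙ extInto G

section Xi

variable {S : ShortComplex (ModuleCat.{u} R)} (hS : S.ShortExact) {C : Cochains R} {n : ℤ}

lemma exists_xi {S : ShortComplex (ModuleCat.{u} R)} (hS : S.ShortExact) {C : Cochains R} {n : ℤ}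
    (z : coneCycles S C n) :
    ∃ φ : C.homology n ⟶ S.X₁, C.homologyπ n ≫ φ ≫ S.f = C.iCycles n ≫ z.1.1 := by
  have := hS.mono_f
  let a : C.homology n ⟶ S.X₂ :=
    C.homologyι n ≫ C.descOpcycles z.1.1 (n - 1) (by simp) (coneCycles_fst z)
  have ha : C.homologyπ n ≫ a = C.iCycles n ≫ z.1.1 := by simp [a]
  have hb : a ≫ S.g = 0 := by
    rw [← cancel_epi (C.homologyπ n), reassoc_of% ha, coneCycles_snd]
    simp
  refine ⟨hS.exact.lift a hb, ?_⟩
  rw [hS.exact.lift_f, ha]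

/-- The homomorphism `ξ(φ', φ'') : H^n(C^*) → G` attached to a cycle `(φ', φ'')` of the cone. -/
def xiFun (z : coneCycles S C n) : C.homology n ⟶ S.X₁ := (exists_xi hS z).choose

/-- `ξ(φ', φ'')` is characterized by `α(ξ(φ', φ'')[c]) = φ'(c)` for all cocycles `c ∈ Z^n`. -/
lemma xiFun_spec (z : coneCycles S C n) :
    C.homologyπ n ≫ xiFun hS z ≫ S.f = C.iCycles n ≫ z.1.1 := (exists_xi hS z).choose_spec

lemma xiFun_unique (z : coneCycles S C n) (φ : C.homology n ⟶ S.X₁)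
    (h : C.homologyπ n ≫ φ ≫ S.f = C.iCycles n ≫ z.1.1) : xiFun hS z = φ := by
  have := hS.mono_f
  rw [← cancel_mono S.f, ← cancel_epi (C.homologyπ n), h, xiFun_spec]

/-- `ξ : Z_n → Hom(H^n(C^*), G)`. -/
def xi (C : Cochains R) (n : ℤ) : coneCycles S C n →ₗ[R] (C.homology n ⟶ S.X₁) where
  toFun z := xiFun hS z
  map_add' z w := xiFun_unique _ _ _ (by
    simp [Preadditive.add_comp, Preadditive.comp_add, xiFun_spec])
  map_smul' r z := xiFun_unique _ _ _ (by simp [xiFun_spec])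

/-- `ξ̄ : H̄_n(C^*; G) → Hom(H^n(C^*), G)`, induced by `ξ`. -/
def xiBarApp (C : Cochains R) (n : ℤ) : coneHomology S C n →ₗ[R] (C.homology n ⟶ S.X₁) :=
  Submodule.liftQ _ (xi hS C n) (by
    rintro z ⟨ψ, hψ⟩
    refine LinearMap.mem_ker.2 (xiFun_unique hS z 0 ?_)
    have : z.1.1 = C.d n (n + 1) ≫ ψ.1 := (congr_arg Prod.fst hψ).symm
    simp [this])

lemma xiBarApp_class (z : coneCycles S C n) :
    xiBarApp hS C n (coneClass S C n z) = xiFun hS z := rfl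

end Xi

/-- `ξ̄ : H̄_n(C^*; G) → Hom(H^n(C^*), G)`, natural in `C^*`. -/
def xiBar {S : ShortComplex (ModuleCat.{u} R)} (hS : S.ShortExact) (n : ℤ) :
    Hbar S n ⟶ homH S.X₁ n where
  app C := ModuleCat.ofHom (xiBarApp hS C.unop n)
  naturality C D f := by
    ext x
    obtain ⟨z, rfl⟩ := Submodule.mkQ_surjective _ x
    refine xiFun_unique hS (coneCyclesMap S f.unop n z)
      (HomologicalComplex.homologyMap f.unop n ≫ xiFun hS z) ?_
    have h1 : (coneCyclesMap S f.unop n z).1.1 = f.unop.f n ≫ z.1.1 := rfl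
    rw [h1]
    simp [xiFun_spec]

section Chi

variable {S : ShortComplex (ModuleCat.{u} R)} [Injective S.X₃] {C : Cochains R} {n : ℤ}

/-- If `φ''` vanishes on boundaries then `(0, -φ'')` is a cycle of the cone. -/
def chiCycle (φ : C.X (n + 1) ⟶ S.X₃) (h : C.d n (n + 1) ≫ φ = 0) : coneCycles S C n :=
  ⟨(0, -φ), by
    rw [LinearMap.mem_ker]
    ext1 <;> simp [h]⟩

lemma extension_d {A : ModuleCat.{u} R} {φ : C.X (n + 1) ⟶ A} {b : C.homology (n + 1) ⟶ A}
    (h : C.iCycles (n + 1) ≫ φ = C.homologyπ (n + 1) ≫ b) : C.d n (n + 1) ≫ φ = 0 := by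
  rw [← C.toCycles_i, Category.assoc, h]
  simp

lemma mem_coneBoundaries_of_iCycles (φ : C.X (n + 1) ⟶ S.X₃) (h : C.iCycles (n + 1) ≫ φ = 0) :
    ((0, φ) : (C.X n ⟶ S.X₂) × (C.X (n + 1) ⟶ S.X₃)) ∈ coneBoundaries S C n := by
  let T : ShortComplex (ModuleCat.{u} R) :=
    ShortComplex.mk (C.iCycles (n + 1)) (C.d (n + 1) (n + 2)) (by simp)
  have hT : T.Exact := T.exact_of_f_is_kernel
    (C.cyclesIsKernel (n + 1) (n + 2) (by simp; ring))
  refine ⟨(0, -hT.descToInjective φ h), ?_⟩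
  ext1
  · simp
  · have := hT.comp_descToInjective φ h
    simpa [T] using this

/-- An extension `φ'' : C^(n+1) → G''` of the composite `Z^(n+1) → H^(n+1)(C^*) → G''`. -/
def extension (b : C.homology (n + 1) ⟶ S.X₃) : C.X (n + 1) ⟶ S.X₃ :=
  Injective.factorThru (C.homologyπ (n + 1) ≫ b) (C.iCycles (n + 1))

lemma extension_spec (b : C.homology (n + 1) ⟶ S.X₃) :
    C.iCycles (n + 1) ≫ extension b = C.homologyπ (n + 1) ≫ b :=
  Injective.comp_factorThru _ _

/-- The class of `(0, -φ'')` does not depend on the extension `φ''`. -/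
lemma chiCycle_class_eq (b : C.homology (n + 1) ⟶ S.X₃) (z : coneCycles S C n)
    (h₁ : z.1.1 = 0) (h₂ : C.iCycles (n + 1) ≫ z.1.2 = -(C.homologyπ (n + 1) ≫ b)) :
    coneClass S C n (chiCycle (extension b) (extension_d (extension_spec b))) =
      coneClass S C n z := by
  rw [coneClass_eq_iff]
  have : (chiCycle (extension b) (extension_d (extension_spec b))).1 - z.1 =
      (0, -extension b - z.1.2) := by
    ext1 <;> simp [chiCycle, h₁]
  rw [this]
  exact mem_coneBoundaries_of_iCycles _ (by
    simp [Preadditive.comp_sub, h₂, extension_spec])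

/-- `χ : Hom(H^(n+1)(C^*), G'') → H̄_n(C^*; G)`, sending `φ̄''` to the class of `(0, -φ'')`, where
`φ'' : C^(n+1) → G''` is any extension of the composite `Z^(n+1) → H^(n+1)(C^*) → G''`. -/
def chi (S : ShortComplex (ModuleCat.{u} R)) [Injective S.X₃] (C : Cochains R) (n : ℤ) :
    (C.homology (n + 1) ⟶ S.X₃) →ₗ[R] coneHomology S C n where
  toFun b := coneClass S C n (chiCycle (extension b) (extension_d (extension_spec b)))
  map_add' a b := by
    rw [← map_add]
    exact chiCycle_class_eq _ _ (by simp [chiCycle])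
      (by simp [chiCycle, Preadditive.comp_add, extension_spec]; abel)
  map_smul' r b := by
    rw [RingHom.id_apply, ← map_smul]
    exact chiCycle_class_eq _ _ (by simp [chiCycle]) (by simp [chiCycle, extension_spec])

lemma chi_eq (b : C.homology (n + 1) ⟶ S.X₃) (z : coneCycles S C n)
    (h₁ : z.1.1 = 0) (h₂ : C.iCycles (n + 1) ≫ z.1.2 = -(C.homologyπ (n + 1) ≫ b)) :
    chi S C n b = coneClass S C n z :=
  chiCycle_class_eq b z h₁ h₂

/-- `χ` vanishes on the image of `β_* : Hom(H^(n+1)(C^*), G') → Hom(H^(n+1)(C^*), G'')`. -/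
lemma chi_comp [Injective S.X₂] (a : C.homology (n + 1) ⟶ S.X₂) : chi S C n (a ≫ S.g) = 0 := by
  let φ : C.X (n + 1) ⟶ S.X₂ :=
    Injective.factorThru (C.homologyπ (n + 1) ≫ a) (C.iCycles (n + 1))
  have hφ : C.iCycles (n + 1) ≫ φ = C.homologyπ (n + 1) ≫ a := Injective.comp_factorThru _ _
  have hd : C.d n (n + 1) ≫ φ = 0 := extension_d hφ
  rw [chi_eq (a ≫ S.g) (chiCycle (φ ≫ S.g) (by rw [reassoc_of% hd, zero_comp]))
    (by simp [chiCycle]) (by simp [chiCycle, reassoc_of% hφ]), ← map_zero (coneClass S C n),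
    coneClass_eq_iff]
  refine ⟨(-φ, 0), ?_⟩
  ext1 <;> simp [chiCycle, hd]

/-- `χ̄ : Ext¹(H^(n+1)(C^*), G) → H̄_n(C^*; G)`, induced by `χ` through the connecting
homomorphism `Hom(H^(n+1)(C^*), G'') → Ext¹(H^(n+1)(C^*), G)`, which is surjective with kernel
the image of `β_*`. -/
def chiBarApp (hS : S.ShortExact) [Injective S.X₂] (C : Cochains R) (n : ℤ) :
    Abelian.Ext.{u} (C.homology (n + 1)) S.X₁ 1 →ₗ[R] coneHomology S C n :=
  Submodule.liftQ (LinearMap.ker (connecting hS (C.homology (n + 1)))) (chi S C n) (by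
    intro b hb
    obtain ⟨a, rfl⟩ := exists_of_connecting_eq_zero hS _ b (LinearMap.mem_ker.1 hb)
    exact LinearMap.mem_ker.2 (chi_comp a)) ∘ₗ
  ((connecting hS (C.homology (n + 1))).quotKerEquivOfSurjective
    (connecting_surjective hS _)).symm.toLinearMap

lemma chiBarApp_connecting (hS : S.ShortExact) [Injective S.X₂]
    (b : C.homology (n + 1) ⟶ S.X₃) :
    chiBarApp hS C n (connecting hS _ b) = chi S C n b := by
  have : ((connecting hS (C.homology (n + 1))).quotKerEquivOfSurjective
      (connecting_surjective hS _)).symm (connecting hS _ b) = Submodule.Quotient.mk b := by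
    rw [LinearEquiv.symm_apply_eq]
    rfl
  simp [chiBarApp, this]

end Chi

/-- `χ̄ : Ext¹(H^(n+1)(C^*), G) → H̄_n(C^*; G)`, natural in `C^*`. -/
def chiBar {S : ShortComplex (ModuleCat.{u} R)} (hS : S.ShortExact) [Injective S.X₂]
    [Injective S.X₃] (n : ℤ) : extH S.X₁ (n + 1) ⟶ Hbar S n where
  app C := ModuleCat.ofHom (chiBarApp hS C.unop n)
  naturality C D f := by
    ext x
    obtain ⟨b, rfl⟩ := connecting_surjective hS (C.unop.homology (n + 1)) x
    change chiBarApp hS D.unop n ((Abelian.Ext.mk₀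
      (HomologicalComplex.homologyMap f.unop (n + 1))).comp (connecting hS _ b) (zero_add 1)) =
      coneHomologyMap S f.unop n (chiBarApp hS C.unop n (connecting hS _ b))
    rw [← connecting_naturality, chiBarApp_connecting, chiBarApp_connecting]
    refine chi_eq _ (coneCyclesMap S f.unop n
      (chiCycle (extension b) (extension_d (extension_spec b)))) ?_ ?_
    · simp [coneCyclesMap, chiCycle]
    · have h1 : (coneCyclesMap S f.unop n
          (chiCycle (extension b) (extension_d (extension_spec b)))).1.2 =
          f.unop.f (n + 1) ≫ (-extension b) := rfl
      rw [h1, Preadditive.comp_neg, Preadditive.comp_neg,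
        ← HomologicalComplex.cyclesMap_i_assoc, extension_spec,
        ← HomologicalComplex.homologyπ_naturality_assoc]

lemma chiBar_xiBar {S : ShortComplex (ModuleCat.{u} R)} (hS : S.ShortExact) [Injective S.X₂]
    [Injective S.X₃] (n : ℤ) : chiBar hS n ≫ xiBar hS n = 0 := by
  ext C x
  obtain ⟨b, rfl⟩ := connecting_surjective hS (C.unop.homology (n + 1)) x
  change xiBarApp hS C.unop n (chiBarApp hS C.unop n (connecting hS _ b)) = 0
  rw [chiBarApp_connecting]
  exact xiFun_unique hS _ _ (by simp [chiCycle])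

section Systems

variable (Γ : Type u) [Preorder Γ] (i : ℕ)

/-- For a contravariant functor `F` on cochain complexes, the contravariant functor sending a
direct system `{C^*_γ}` indexed by `Γ` to `lim^(i)` of the inverse system `{F(C^*_γ)}`. -/
abbrev limDSystem (F : (Cochains R)ᵒᵖ ⥤ ModuleCat.{u} R) :
    (Γ ⥤ Cochains R)ᵒᵖ ⥤ ModuleCat.{u} R :=
  Functor.opHom Γ (Cochains R) ⋙ (Functor.whiskeringRight _ _ _).obj F ⋙ limD R Γ i

/-- The homomorphisms `lim^(i) {F(C^*_γ)} → lim^(i) {F'(C^*_γ)}` induced by a natural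
transformation `F ⟶ F'`. -/
abbrev limDSystemMap {F F' : (Cochains R)ᵒᵖ ⥤ ModuleCat.{u} R} (t : F ⟶ F') :
    limDSystem Γ i F ⟶ limDSystem Γ i F' :=
  Functor.whiskerLeft (Functor.opHom Γ (Cochains R))
    (Functor.whiskerRight ((Functor.whiskeringRight Γᵒᵖ _ _).map t) (limD R Γ i))

lemma limDSystemMap_comp_eq_zero {F F' F'' : (Cochains R)ᵒᵖ ⥤ ModuleCat.{u} R}
    (s : F ⟶ F') (t : F' ⟶ F'') (h : s ≫ t = 0) :
    limDSystemMap Γ i s ≫ limDSystemMap Γ i t = 0 := by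
  ext1
  ext1 C
  have : (limD R Γ i).map (Functor.whiskerLeft C.unop.op (s ≫ t)) = 0 := by
    rw [h]
    exact (limD R Γ i).map_zero _ _
  rw [Functor.whiskerLeft_comp, Functor.map_comp] at this
  exact this

/-- The sequence
`lim^(i) Ext¹(H^(n+1)(C^*_γ), G) → lim^(i) H̄_n(C^*_γ; G) → lim^(i) Hom(H^n(C^*_γ), G)`,
with maps `lim^(i) χ̄` and `lim^(i) ξ̄`, as functors of the direct system `{C^*_γ}`. -/
def limSequence {S : ShortComplex (ModuleCat.{u} R)} (hS : S.ShortExact) [Injective S.X₂]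
    [Injective S.X₃] (n : ℤ) : ShortComplex ((Γ ⥤ Cochains R)ᵒᵖ ⥤ ModuleCat.{u} R) :=
  ShortComplex.mk (limDSystemMap Γ i (chiBar hS n)) (limDSystemMap Γ i (xiBar hS n))
    (limDSystemMap_comp_eq_zero Γ i _ _ (chiBar_xiBar hS n))

end Systems

end UCF

end

/-! Two facts about inverse systems carry the proof. First, `lim` is `Hom(R, -)` out of the constant
system `R`, so `lim^(i)` is `Ext^i(R, -)`, and iterated connecting homomorphisms become Yoneda
products with extension classes. Second, for `I` injective and `{A_γ}` a direct system over a
directed set, the system `{Hom(A_γ, I)}` is acyclic for `lim` (`ext_dualSystem_eq_zero`).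

For each `C^*` the sequence `0 → Ext → H̄_n → Hom → 0` is exact, so everything reduces to a natural
left inverse of `lim^(i) χ̄` for `i ≥ 1`. It comes from comparing two four-term exact sequences: `0
→ Hom(H^(n+1), G) → Hom(H^(n+1), G') → Hom(H^(n+1), G'') → Ext(H^(n+1), G) → 0` and `0 →
Hom(H^(n+1), G) → Hom(Z^(n+1), G') → T_n → H̄_n → 0`, where `T_n` consists of the cycles of the cone
with `φ''` restricted to cocycles. This restriction discards the redundant part of `φ''`, so that
the kernel at the left is exactly `Hom(H^(n+1), G)`. A morphism from the first sequence to the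
second is the identity at the left end and `χ̄` at the right end.

By naturality of the class in `Ext²`, the double connecting homomorphism `lim^(i) Ext(H^(n+1), G) →
lim^(i+2) Hom(H^(n+1), G)` factors as `lim^(i) χ̄` followed by that of the second sequence. For `i ≥
1` it is an isomorphism, because the middle terms of the first sequence are acyclic; hence `lim^(i)
χ̄` is naturally split injective. For `i = 0` it is injective by left exactness. Injectivity in all
degrees makes the connecting homomorphisms of the long exact sequence vanish, which cuts it into
short exact sequences. -/

noncomputable section

namespace UCF

/-! ### Right derived functors of `Hom(X, -)` and `Ext` -/

section ExtFunctor

universe v w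

variable (R : Type u) [CommRing R] {A : Type w} [Category.{v} A] [Abelian A] [Linear R A]

variable {R} {X : A}

variable (R X) in
/-- The functor `Hom(X, -)` with values in `R`-modules. -/
abbrev homFrom : A ⥤ ModuleCat.{v} R := (linearCoyoneda R A).obj (op X)

variable (R) in
/-- The complex `Hom(X, I^*)`. -/
abbrev homComplex (X : A) {F : A} (I : InjectiveResolution F) : CochainComplex (ModuleCat.{v} R) ℕ :=
  ((homFrom R X).mapHomologicalComplex _).obj I.cocomplex

lemma iCycles_injective {F : A} (I : InjectiveResolution F) (i : ℕ) :
    Function.Injective ((homComplex R X I).iCycles i) :=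
  (ModuleCat.mono_iff_injective _).1 inferInstance

lemma exists_cycle {F : A} (I : InjectiveResolution F) (i : ℕ) (f : X ⟶ I.cocomplex.X i)
    (hf : f ≫ I.cocomplex.d i (i + 1) = 0) :
    ∃ x : (homComplex R X I).cycles i, (homComplex R X I).iCycles i x = f := by
  let K := homComplex R X I
  let T : ShortComplex (ModuleCat.{v} R) :=
    ShortComplex.mk (K.iCycles i) (K.d i (i + 1)) (by simp)
  have hT : T.Exact := T.exact_of_f_is_kernel (K.cyclesIsKernel i (i + 1) (by simp))
  exact (ShortComplex.moduleCat_exact_iff T).1 hT f hf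

variable [HasExt.{v} A]

variable (R X) in
/-- The functor `Ext^i(X, -)` with values in `R`-modules. -/
@[simps]
def extFunctor (i : ℕ) : A ⥤ ModuleCat.{v} R where
  obj F := ModuleCat.of R (Abelian.Ext.{v} X F i)
  map f := ModuleCat.ofHom (Abelian.Ext.postcompOfLinear (Abelian.Ext.mk₀ f) R X (add_zero i))
  map_id F := by ext x; simp
  map_comp f g := by ext x; simp

/-- Multiplication by `r` is precomposition with `r • 𝟙 X`, and `extMk` is compatible with
precomposition. -/
lemma smul_extMk {F : A} (I : InjectiveResolution F) {n : ℕ} (f : X ⟶ I.cocomplex.X n) (m : ℕ)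
    (hm : n + 1 = m) (hf : f ≫ I.cocomplex.d n m = 0) (r : R) :
    r • I.extMk f m hm hf = I.extMk (r • f) m hm (by simp [hf]) := by
  have := I.mk₀_comp_extMk f m hm hf (r • 𝟙 X)
  rw [Abelian.Ext.mk₀_smul, Abelian.Ext.smul_comp, Abelian.Ext.mk₀_id_comp] at this
  simpa using this

/-- In degree `0` there are no nonzero coboundaries, since the resolution, extended by zero to `ℤ`,
vanishes in degree `-1`. -/
lemma extMk_zero_injective {F : A} (I : InjectiveResolution F) (f : X ⟶ I.cocomplex.X 0) (m : ℕ)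
    (hm : 0 + 1 = m) (hf : f ≫ I.cocomplex.d 0 m = 0) (h : I.extMk f m hm hf = 0) : f = 0 := by
  rw [← I.extEquivCohomologyClass.apply_eq_iff_eq, I.extEquivCohomologyClass_extMk,
    I.extEquivCohomologyClass_zero, CochainComplex.HomComplex.CohomologyClass.mk_eq_zero_iff,
    CochainComplex.HomComplex.Cocycle.fromSingleMk_mem_coboundaries_iff _ _ _ _ _ (-1 : ℤ)
      (by lia)] at h
  obtain ⟨g, hg⟩ := h
  have h0 : IsZero (I.cochainComplex.X (-1)) := I.cochainComplex.isZero_of_isStrictlyGE 0 (-1)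
  rw [h0.eq_of_tgt g 0, zero_comp] at hg
  exact (cancel_mono (I.cochainComplexXIso 0 0 rfl).inv).1 (hg.symm.trans zero_comp.symm)

variable (R) in
/-- The homomorphism from cocycles of `Hom(X, I^*)` to `Ext^i(X, F)`. -/
def cocycleToExt (X : A) {F : A} (I : InjectiveResolution F) (i : ℕ) :
    LinearMap.ker (Linear.rightComp R X (I.cocomplex.d i (i + 1))) →ₗ[R]
      Abelian.Ext.{v} X F i where
  toFun x := I.extMk x.1 (i + 1) rfl x.2
  map_add' x y := (I.add_extMk _ _ _ _ x.2 y.2).symm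
  map_smul' r x := (smul_extMk I _ _ _ x.2 r).symm

variable (R) in
/-- The homomorphism from cocycles of `Hom(X, I^*)` to `Ext^i(X, F)`. -/
def cyclesToExt (X : A) {F : A} (I : InjectiveResolution F) (i : ℕ) :
    (homComplex R X I).cycles i ⟶ (extFunctor R X i).obj F :=
  ModuleCat.ofHom (cocycleToExt R X I i ∘ₗ
    LinearMap.codRestrict _ ((homComplex R X I).iCycles i).hom fun x =>
      LinearMap.mem_ker.2 (by
        have := (homComplex R X I).iCycles_d i (i + 1)
        exact congr($this x)))

lemma cyclesToExt_apply {F : A} (I : InjectiveResolution F) (i : ℕ)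
    (x : (homComplex R X I).cycles i) (f : X ⟶ I.cocomplex.X i)
    (hf : f ≫ I.cocomplex.d i (i + 1) = 0) (h : (homComplex R X I).iCycles i x = f) :
    cyclesToExt R X I i x = I.extMk f (i + 1) rfl hf := by
  subst h
  rfl

lemma epi_cyclesToExt {F : A} (I : InjectiveResolution F) (i : ℕ) :
    Epi (cyclesToExt R X I i) := by
  rw [ModuleCat.epi_iff_surjective]
  intro y
  obtain ⟨f, hf, rfl⟩ := I.extMk_surjective y (i + 1) rfl
  obtain ⟨x, hx⟩ := exists_cycle (R := R) I i f hf
  exact ⟨x, cyclesToExt_apply I i x f hf hx⟩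

lemma toCycles_cyclesToExt {F : A} (I : InjectiveResolution F) (j i : ℕ) :
    (homComplex R X I).toCycles j i ≫ cyclesToExt R X I i = 0 := by
  by_cases hji : j + 1 = i
  · ext g
    let g' : X ⟶ I.cocomplex.X j := g
    have h : (homComplex R X I).iCycles i ((homComplex R X I).toCycles j i g) =
        g' ≫ I.cocomplex.d j i := by
      have := (homComplex R X I).toCycles_i j i
      exact congr($this g)
    exact (cyclesToExt_apply I i _ _ (by simp) h).trans
      ((I.extMk_eq_zero_iff _ _ _ _ j hji).2 ⟨g', rfl⟩)
  -- This case occurs at `i = 0`, whose predecessor in the complex shape is `0` itself.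
  · rw [(homComplex R X I).toCycles_eq_zero (by simpa using hji), zero_comp]

/-- This is the injectivity of `homologyToExt`, tested on representing cocycles. -/
lemma homologyπ_eq_zero_of_cyclesToExt_eq_zero {F : A} (I : InjectiveResolution F) (i : ℕ)
    (x : (homComplex R X I).cycles i) (h : cyclesToExt R X I i x = 0) :
    (homComplex R X I).homologyπ i x = 0 := by
  obtain ⟨f, hx⟩ : ∃ f : X ⟶ I.cocomplex.X i, (homComplex R X I).iCycles i x = f := ⟨_, rfl⟩
  have hf : f ≫ I.cocomplex.d i (i + 1) = 0 := by
    have := (homComplex R X I).iCycles_d i (i + 1)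
    subst hx
    exact congr($this x)
  rw [cyclesToExt_apply I i x f hf hx] at h
  obtain _ | j := i
  · have h0 := extMk_zero_injective I f _ _ hf h
    have : x = 0 := iCycles_injective I 0 (by rw [hx, map_zero, h0]; rfl)
    rw [this, map_zero]
  · obtain ⟨g, hg⟩ := (I.extMk_eq_zero_iff _ _ _ _ j rfl).1 h
    have : x = (homComplex R X I).toCycles j (j + 1) g := iCycles_injective I _ (by
      have := (homComplex R X I).toCycles_i j (j + 1)
      rw [hx, ← hg]
      exact congr($this.symm g))
    rw [this]
    exact congr($((homComplex R X I).toCycles_comp_homologyπ j (j + 1)) g)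

variable (R) in
/-- The homomorphism `H^i(Hom(X, I^*)) → Ext^i(X, F)` for an injective resolution `I` of `F`. -/
def homologyToExt (X : A) {F : A} (I : InjectiveResolution F) (i : ℕ) :
    (homComplex R X I).homology i ⟶ (extFunctor R X i).obj F :=
  ((homComplex R X I).homologyIsCokernel _ i rfl).desc
    (CokernelCofork.ofπ (cyclesToExt R X I i) (toCycles_cyclesToExt I _ i))

@[simp]
lemma homologyπ_homologyToExt {F : A} (I : InjectiveResolution F) (i : ℕ) :
    (homComplex R X I).homologyπ i ≫ homologyToExt R X I i = cyclesToExt R X I i :=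
  Cofork.IsColimit.π_desc ((homComplex R X I).homologyIsCokernel _ i rfl)

instance isIso_homologyToExt {F : A} (I : InjectiveResolution F) (i : ℕ) :
    IsIso (homologyToExt R X I i) := by
  have := epi_cyclesToExt (R := R) (X := X) I i
  have : Epi (homologyToExt R X I i) := epi_of_epi_fac (homologyπ_homologyToExt I i)
  have : Mono (homologyToExt R X I i) := by
    rw [ModuleCat.mono_iff_injective, injective_iff_map_eq_zero]
    intro y hy
    obtain ⟨x, rfl⟩ := (ModuleCat.epi_iff_surjective _).1
      (inferInstance : Epi ((homComplex R X I).homologyπ i)) y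
    refine homologyπ_eq_zero_of_cyclesToExt_eq_zero I i x ?_
    rw [← homologyπ_homologyToExt]
    exact hy
  exact isIso_of_mono_of_epi _

lemma homologyToExt_naturality {F G : A} (f : F ⟶ G) (I : InjectiveResolution F)
    (J : InjectiveResolution G) (φ : InjectiveResolution.Hom I J f) (i : ℕ) :
    HomologicalComplex.homologyMap
      (((homFrom R X).mapHomologicalComplex _).map φ.hom) i ≫ homologyToExt R X J i =
      homologyToExt R X I i ≫ (extFunctor R X i).map f := by
  rw [← cancel_epi ((homComplex R X I).homologyπ i),
    HomologicalComplex.homologyπ_naturality_assoc, homologyπ_homologyToExt,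
    reassoc_of% homologyπ_homologyToExt (R := R) (X := X) I i]
  ext x
  obtain ⟨g, hx⟩ : ∃ g : X ⟶ I.cocomplex.X i, (homComplex R X I).iCycles i x = g := ⟨_, rfl⟩
  have hg : g ≫ I.cocomplex.d i (i + 1) = 0 := by
    have := (homComplex R X I).iCycles_d i (i + 1)
    subst hx
    exact congr($this x)
  have h := I.extMk_comp_mk₀ g _ rfl hg φ
  have h1 : (homComplex R X J).iCycles i (HomologicalComplex.cyclesMap
      (((homFrom R X).mapHomologicalComplex _).map φ.hom) i x) = g ≫ φ.hom.f i := by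
    have := HomologicalComplex.cyclesMap_i
      (((homFrom R X).mapHomologicalComplex _).map φ.hom) i
    rw [← hx]
    exact congr($this x)
  have h2 := cyclesToExt_apply J i _ _ (by simp [reassoc_of% hg]) h1
  refine h2.trans (h.symm.trans ?_)
  rw [← cyclesToExt_apply I i x g hg hx]
  rfl

variable (R) in
/-- The right derived functors of `Hom(X, -)` are `Ext^i(X, -)`. -/
def rightDerivedHomFromIso [HasInjectiveResolutions A] (X : A) (i : ℕ) :
    (homFrom R X).rightDerived i ≅ extFunctor R X i :=
  NatIso.ofComponents (fun F => (injectiveResolution F).isoRightDerivedObj (homFrom R X) i ≪≫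
    @asIso _ _ _ _ _ (isIso_homologyToExt (R := R) (X := X) (injectiveResolution F) i)) (by
    intro F G f
    let φ : InjectiveResolution.Hom (injectiveResolution F) (injectiveResolution G) f :=
      { hom := InjectiveResolution.desc f _ _
        ι_f_zero_comp_hom_f_zero :=
          HomologicalComplex.congr_hom (InjectiveResolution.desc_commutes f _ _) 0 }
    dsimp only [Iso.trans_hom, asIso_hom]
    rw [InjectiveResolution.isoRightDerivedObj_hom_naturality_assoc f (injectiveResolution F)
      (injectiveResolution G) φ.hom (InjectiveResolution.desc_commutes_zero f _ _) (homFrom R X) i,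
      Category.assoc]
    congr 1
    exact homologyToExt_naturality f _ _ φ i)

end ExtFunctor

/-! ### The derived limits as `Ext` out of the constant system -/

section LimD

variable (R : Type u) [CommRing R] (Γ : Type u) [Preorder Γ]

instance isGrothendieckAbelian_inverseSystem :
    IsGrothendieckAbelian.{u} (Γᵒᵖ ⥤ ModuleCat.{u} R) :=
  IsGrothendieckAbelian.of_equivalence (sheafBotEquivalence (C := Γ) (ModuleCat.{u} R))

/-- The constant inverse system `R`. -/
abbrev unitSystem : Γᵒᵖ ⥤ ModuleCat.{u} R := (Functor.const _).obj (ModuleCat.of R R)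

/-- Elements of the inverse limit are morphisms from the constant system `R`. -/
def homFromUnitEquiv (F : Γᵒᵖ ⥤ ModuleCat.{u} R) : (unitSystem R Γ ⟶ F) ≃ₗ[R] (lim.obj F :) :=
  LinearEquiv.ofBijective
    { toFun f := (limit.lift F ⟨_, f⟩).hom (1 : R)
      map_add' f g := by
        have : limit.lift F ⟨_, f + g⟩ = limit.lift F ⟨_, f⟩ + limit.lift F ⟨_, g⟩ :=
          limit.hom_ext fun j => by simp [Preadditive.add_comp]
        rw [this]
        rfl
      map_smul' r f := by
        have : limit.lift F ⟨_, r • f⟩ = r • limit.lift F ⟨_, f⟩ :=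
          limit.hom_ext fun j => by simp
        rw [this]
        rfl } (by
    refine ⟨fun f g h => ?_, fun x => ?_⟩
    · have : limit.lift F ⟨_, f⟩ = limit.lift F ⟨_, g⟩ :=
        ModuleCat.hom_ext (LinearMap.ext_ring h)
      ext1
      ext1 j
      simpa using congr($this ≫ limit.π F j)
    -- An element `x` of the limit is the same as a map `R → lim F`, whose projections form the
    -- required morphism of systems.
    · let a : ModuleCat.of R R ⟶ lim.obj F := ModuleCat.ofHom (LinearMap.toSpanSingleton R _ x)
      refine ⟨{ app j := a ≫ limit.π F j }, ?_⟩
      have : limit.lift F ⟨_, { app j := a ≫ limit.π F j }⟩ = a :=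
        limit.hom_ext fun j => by simp
      dsimp only [LinearMap.coe_mk, AddHom.coe_mk]
      rw [this]
      exact one_smul R x)

/-- The inverse limit functor is `Hom(R, -)`. -/
def limIso : (lim : (Γᵒᵖ ⥤ ModuleCat.{u} R) ⥤ ModuleCat.{u} R) ≅ homFrom R (unitSystem R Γ) :=
  (NatIso.ofComponents (fun F => (homFromUnitEquiv R Γ F).toModuleIso) (by
    intro F G t
    ext f
    have : limit.lift G ⟨_, f ≫ t⟩ = limit.lift F ⟨_, f⟩ ≫ limMap t :=
      limit.hom_ext fun j => by simp
    exact congr($this (1 : R)))).symm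

/-- Isomorphic additive functors have isomorphic right derived functors. -/
def rightDerivedIso {A B : Type*} [Category* A] [Category* B] [Abelian A]
    [HasInjectiveResolutions A] [Abelian B] {F G : A ⥤ B} [F.Additive] [G.Additive] (e : F ≅ G)
    (i : ℕ) : F.rightDerived i ≅ G.rightDerived i where
  hom := NatTrans.rightDerived e.hom i
  inv := NatTrans.rightDerived e.inv i
  hom_inv_id := by rw [← NatTrans.rightDerived_comp, e.hom_inv_id, NatTrans.rightDerived_id]
  inv_hom_id := by rw [← NatTrans.rightDerived_comp, e.inv_hom_id, NatTrans.rightDerived_id]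

/-- `lim^(i)` is `Ext^i(R, -)`. -/
def limDIso (i : ℕ) : limD R Γ i ≅ extFunctor R (unitSystem R Γ) i :=
  rightDerivedIso (limIso R Γ) i ≪≫ rightDerivedHomFromIso R (unitSystem R Γ) i

end LimD

/-! ### Exactness and projectives in functor categories -/

section FunctorCategory

variable {J : Type*} [Category* J] {B : Type*} [Category* B] [Abelian B]

/-- Evaluation is exact, hence commutes with homology, and a functor with zero values is zero. -/
lemma exact_of_evaluation (S : ShortComplex (J ⥤ B))
    (h : ∀ j, (S.map ((evaluation J B).obj j)).Exact) : S.Exact := by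
  rw [ShortComplex.exact_iff_isZero_homology]
  exact Functor.isZero _ fun j => ((ShortComplex.exact_iff_isZero_homology _).1 (h j)).of_iso
    (S.mapHomologyIso ((evaluation J B).obj j)).symm

lemma shortExact_of_evaluation (S : ShortComplex (J ⥤ B))
    (h : ∀ j, (S.map ((evaluation J B).obj j)).ShortExact) : S.ShortExact where
  exact := exact_of_evaluation S fun j => (h j).exact
  mono_f := by
    have (j : J) : Mono (S.f.app j) := (h j).mono_f
    exact NatTrans.mono_of_mono_app _
  epi_g := by
    have (j : J) : Epi (S.g.app j) := (h j).epi_g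
    exact NatTrans.epi_of_epi_app _

lemma shortExact_evaluation {S : ShortComplex (J ⥤ B)} (h : S.ShortExact) (j : J) :
    (S.map ((evaluation J B).obj j)).ShortExact :=
  h.map_of_exact _

lemma shortExact_whiskeringLeft {K : Type*} [Category* K] {S : ShortComplex (J ⥤ B)}
    (h : S.ShortExact) (F : K ⥤ J) :
    (S.map ((Functor.whiskeringLeft K J B).obj F)).ShortExact :=
  shortExact_of_evaluation _ fun k => shortExact_evaluation h (F.obj k)

end FunctorCategory

section EnoughProjectives

universe w

variable {J : Type u} [SmallCategory J] {B : Type w} [Category.{u} B] [Abelian B]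
  [EnoughProjectives B] [HasColimitsOfSize.{u, u} B]

/-- The left adjoint of evaluation at `j` preserves projectives because evaluation preserves
epimorphisms. Summing over `j` its values on projective covers of `F.obj j` gives a projective
mapping onto `F`. -/
instance enoughProjectives_functor : EnoughProjectives (J ⥤ B) where
  presentation F := by
    let L (j : J) : J ⥤ B := (evaluationLeftAdjoint B j).obj (Projective.over (F.obj j))
    let a (j : J) : L j ⟶ F :=
      ((evaluationAdjunctionRight B j).homEquiv _ _).symm (Projective.π (F.obj j))
    have (j : J) : Projective (L j) :=
      (evaluationAdjunctionRight B j).map_projective _ inferInstance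
    have (j : J) : Epi ((Sigma.desc a).app j) := by
      -- At `j`, the `j`-th summand alone suffices: composing with the unit recovers the chosen
      -- epimorphism onto `F.obj j`.
      refine epi_of_epi_fac (f := (evaluationAdjunctionRight B j).unit.app _ ≫ (Sigma.ι L j).app j)
        (h := Projective.π (F.obj j)) ?_
      rw [Category.assoc, ← NatTrans.comp_app, Sigma.ι_desc]
      exact ((evaluationAdjunctionRight B j).homEquiv_unit _ _ _).symm.trans
        (Equiv.apply_symm_apply _ _)
    exact ⟨{ p := ∐ L, f := Sigma.desc a, epi := NatTrans.epi_of_epi_app _ }⟩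

end EnoughProjectives

/-! ### Dimension shifting -/

section DimensionShift

universe v w

variable {A : Type w} [Category.{v} A] [Abelian A]

lemma shortExact_projective [EnoughProjectives A] (X : A) :
    (ShortComplex.mk (kernel.ι (Projective.π X)) (Projective.π X)
      (kernel.condition _)).ShortExact where
  exact := ShortComplex.exact_of_f_is_kernel _ (kernelIsKernel _)
  mono_f := inferInstanceAs (Mono (kernel.ι _))
  epi_g := inferInstanceAs (Epi (Projective.π _))

variable [HasExt.{v} A]

/-- As `S.X₂` is injective, every class is a connecting image of some `X ⟶ S.X₃`; such a map lifts
to `S.X₂`, so its image vanishes. -/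
lemma ext_one_eq_zero {S : ShortComplex A} (hS : S.ShortExact) (hI : Injective S.X₂) {X : A}
    (h : ∀ f : X ⟶ S.X₃, ∃ g, g ≫ S.g = f) (x : Abelian.Ext.{v} X S.X₁ 1) : x = 0 := by
  obtain ⟨y, rfl⟩ := Abelian.Ext.covariant_sequence_exact₁ (hS := hS) _ x
    (Abelian.Ext.eq_zero_of_injective _) (zero_add 1)
  obtain ⟨f, rfl⟩ := (Abelian.Ext.mk₀_bijective _ _).2 y
  obtain ⟨g, rfl⟩ := h f
  rw [← Abelian.Ext.mk₀_comp_mk₀_assoc, hS.comp_extClass, Abelian.Ext.comp_zero]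

lemma ext_succ_eq_zero {S : ShortComplex A} (hS : S.ShortExact) (hI : Injective S.X₂) {X : A}
    (i : ℕ) (h : ∀ y : Abelian.Ext.{v} X S.X₃ (i + 1), y = 0)
    (x : Abelian.Ext.{v} X S.X₁ (i + 1 + 1)) : x = 0 := by
  obtain ⟨y, rfl⟩ := Abelian.Ext.covariant_sequence_exact₁ (hS := hS) _ x
    (Abelian.Ext.eq_zero_of_injective _) (rfl : (i + 1) + 1 = i + 1 + 1)
  rw [h y, Abelian.Ext.zero_comp]

end DimensionShift

/-! ### Acyclicity of dual systems -/

section Acyclic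

variable {R : Type u} [CommRing R] {Γ : Type u} [Preorder Γ]

/-- The inverse system `{Hom(A_γ, I)}` of a direct system `{A_γ}`. -/
abbrev dualSystem (I : ModuleCat.{u} R) : (Γ ⥤ ModuleCat.{u} R)ᵒᵖ ⥤ (Γᵒᵖ ⥤ ModuleCat.{u} R) :=
  Functor.opHom Γ (ModuleCat.{u} R) ⋙ (Functor.whiskeringRight _ _ _).obj (homInto I)

/-- Interchanging the arguments of a bilinear map `M → N → I`. -/
def flipHom {I M N : ModuleCat.{u} R} (f : M ⟶ (homInto I).obj (op N)) :
    N ⟶ (homInto I).obj (op M) :=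
  ModuleCat.ofHom
  { toFun y := ModuleCat.ofHom
      { toFun x := (show N ⟶ I from f x) y
        map_add' x x' := by rw [map_add]; rfl
        map_smul' r x := by rw [map_smul]; rfl }
    map_add' y y' := by
      ext x
      exact map_add (show N ⟶ I from f x).hom y y'
    map_smul' r y := by
      ext x
      exact map_smul (show N ⟶ I from f x).hom r y }

/-- Maps `N → Hom(P, I)` correspond to maps `P → Hom(N, I)`. Extending along a monomorphism `N → N'`
thus becomes lifting along `Hom(N', I) → Hom(N, I)`, which is epi since `I` is injective, and `P` is
projective. -/
instance injective_dualSystem (I : ModuleCat.{u} R) [Injective I] (P : Γ ⥤ ModuleCat.{u} R)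
    [Projective P] : Injective ((dualSystem I).obj (op P)) where
  factors {N N'} g f hf := by
    let D (N : Γᵒᵖ ⥤ ModuleCat.{u} R) : Γ ⥤ ModuleCat.{u} R := N.rightOp ⋙ homInto I
    let φ : D N' ⟶ D N := Functor.whiskerRight (NatTrans.rightOp f) (homInto I)
    have hφ (γ : Γ) : Epi (φ.app γ) := by
      rw [ModuleCat.epi_iff_surjective]
      intro x
      let x' : N.obj (op γ) ⟶ I := x
      exact ⟨Injective.factorThru x' (f.app (op γ)), Injective.comp_factorThru x' (f.app (op γ))⟩
    have : Epi φ := NatTrans.epi_of_epi_app _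
    let g' : P ⟶ D N :=
      { app γ := flipHom (g.app (op γ))
        naturality γ γ' a := by
          ext x
          refine ModuleCat.hom_ext (LinearMap.ext fun y => ?_)
          exact congr((show P.obj γ ⟶ I from $(g.naturality a.op) y) x).symm }
    let l : P ⟶ D N' := Projective.factorThru g' φ
    have hl : l ≫ φ = g' := Projective.factorThru_comp g' φ
    refine ⟨{ app γ := flipHom (l.app γ.unop), naturality := ?_ }, ?_⟩
    · intro γ γ' a
      ext x
      refine ModuleCat.hom_ext (LinearMap.ext fun y => ?_)
      exact congr((show N'.obj γ ⟶ I from $(l.naturality a.unop) y) x).symm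
    · ext γ x
      refine ModuleCat.hom_ext (LinearMap.ext fun y => ?_)
      exact congr((show N.obj γ ⟶ I from ($hl).app γ.unop y) x)

lemma shortExact_homInto (I : ModuleCat.{u} R) [Injective I] {S : ShortComplex (ModuleCat.{u} R)}
    (hS : S.ShortExact) : (S.op.map (homInto I)).ShortExact := by
  have hf : Mono S.f := hS.mono_f
  have hg : Epi S.g := hS.epi_g
  refine ModuleCat.shortComplex_shortExact _ ?_ ?_ ?_
  · refine (ShortComplex.ShortExact.moduleCat_exact_iff_function_exact _).1
      ((ShortComplex.moduleCat_exact_iff _).2 fun (x : S.X₂ ⟶ I) hx => ?_)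
    exact ⟨hS.exact.desc x hx, hS.exact.g_desc x hx⟩
  · intro (x : S.X₃ ⟶ I) (y : S.X₃ ⟶ I) h
    exact (cancel_epi S.g).1 h
  · intro (x : S.X₁ ⟶ I)
    obtain ⟨y, hy⟩ : ∃ y, S.f ≫ y = x :=
      ⟨Injective.factorThru x S.f, Injective.comp_factorThru x S.f⟩
    exact ⟨y, hy⟩

instance preservesZeroMorphisms_dualSystem (I : ModuleCat.{u} R) :
    (dualSystem (Γ := Γ) I).PreservesZeroMorphisms where
  map_zero A B := by
    ext1
    ext1 γ
    exact (homInto I).map_zero _ _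

lemma shortExact_dualSystem (I : ModuleCat.{u} R) [Injective I]
    {S : ShortComplex (Γ ⥤ ModuleCat.{u} R)} (hS : S.ShortExact) :
    (S.op.map (dualSystem I)).ShortExact :=
  shortExact_of_evaluation _ fun γ => shortExact_homInto I (shortExact_evaluation hS γ.unop)

variable [IsDirectedOrder Γ] [Nonempty Γ]

/-- The constant functor is right adjoint to `colim`, which preserves monomorphisms because `Γ` is
directed. -/
instance injective_const (I : ModuleCat.{u} R) [Injective I] :
    Injective ((Functor.const Γ).obj I) :=
  Injective.injective_of_adjoint colimConstAdj I

/-- A morphism from the constant system `R` to `{Hom(K_γ, I)}` is a compatible family `K_γ → I`,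
that is, a morphism from `K` to the constant system `I`. The latter is injective, so the morphism
extends to `P`. -/
lemma exists_lift_dualSystem (I : ModuleCat.{u} R) [Injective I] {K P : Γ ⥤ ModuleCat.{u} R}
    (j : K ⟶ P) [Mono j] (f : unitSystem R Γ ⟶ (dualSystem I).obj (op K)) :
    ∃ g : unitSystem R Γ ⟶ (dualSystem I).obj (op P), g ≫ (dualSystem I).map j.op = f := by
  let h : K ⟶ (Functor.const Γ).obj I :=
    { app γ := f.app (op γ) (1 : R)
      naturality γ γ' a := by
        have := congr($(f.naturality a.op) (1 : R))
        exact this.symm.trans (Category.comp_id _).symm }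
  let h' : P ⟶ (Functor.const Γ).obj I := Injective.factorThru h j
  have hh : j ≫ h' = h := Injective.comp_factorThru h j
  refine ⟨{ app γ := ModuleCat.ofHom (LinearMap.toSpanSingleton R _ (h'.app γ.unop))
            naturality := ?_ }, ?_⟩
  · intro γ γ' a
    refine ModuleCat.hom_ext (LinearMap.ext_ring ?_)
    change (1 : R) • h'.app γ'.unop = P.map a.unop ≫ ((1 : R) • h'.app γ.unop)
    rw [one_smul, one_smul, h'.naturality]
    exact (Category.comp_id _).symm
  · ext1
    ext1 γ
    refine ModuleCat.hom_ext (LinearMap.ext_ring ?_)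
    change j.app γ.unop ≫ ((1 : R) • h'.app γ.unop) = h.app γ.unop
    rw [one_smul, ← hh]
    rfl

/-- Present `A` as a quotient of a projective `P` with kernel `K`. Then `0 → Hom(A, I) → Hom(P, I) →
Hom(K, I) → 0` is exact with injective middle term, which shifts dimension from `A` to `K`; the base
case is the lifting of `exists_lift_dualSystem`. -/
theorem ext_dualSystem_eq_zero (I : ModuleCat.{u} R) [Injective I] (i : ℕ)
    (A : Γ ⥤ ModuleCat.{u} R)
    (x : Abelian.Ext.{u} (unitSystem R Γ) ((dualSystem I).obj (op A)) (i + 1)) : x = 0 := by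
  induction i generalizing A with
  | zero =>
    have hD := shortExact_dualSystem I (shortExact_projective A)
    have : Injective _ := injective_dualSystem I (Projective.over A)
    exact ext_one_eq_zero hD this (exists_lift_dualSystem I (kernel.ι (Projective.π A))) x
  | succ i ih =>
    have hD := shortExact_dualSystem I (shortExact_projective A)
    have : Injective _ := injective_dualSystem I (Projective.over A)
    exact ext_succ_eq_zero hD this i (ih _) x

end Acyclic

/-! ### Four-term exact sequences -/

section FourTerm

universe v w

/-- An exact sequence `0 → X₀ → X₁ → X₂ → X₃ → 0`. -/
structure FourTerm (A : Type w) [Category.{v} A] [Abelian A] where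
  {X₀ X₁ X₂ X₃ : A}
  a : X₀ ⟶ X₁
  b : X₁ ⟶ X₂
  c : X₂ ⟶ X₃
  a_b : a ≫ b = 0
  b_c : b ≫ c = 0
  mono_a : Mono a
  exact₁ : (ShortComplex.mk a b a_b).Exact
  exact₂ : (ShortComplex.mk b c b_c).Exact
  epi_c : Epi c

namespace FourTerm

variable {A : Type w} [Category.{v} A] [Abelian A] (E : FourTerm A)

/-- The left half `0 → X₀ → X₁ → ker c → 0`. -/
abbrev left : ShortComplex A :=
  ShortComplex.mk E.a (kernel.lift E.c E.b E.b_c) (by simp [← cancel_mono (kernel.ι E.c), E.a_b])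

/-- The right half `0 → ker c → X₂ → X₃ → 0`. -/
abbrev right : ShortComplex A := ShortComplex.mk (kernel.ι E.c) E.c (kernel.condition _)

lemma shortExact_left : E.left.ShortExact where
  mono_f := E.mono_a
  epi_g := (ShortComplex.exact_iff_epi_kernel_lift _).1 E.exact₂
  exact := by
    let φ : E.left ⟶ ShortComplex.mk E.a E.b E.a_b := { τ₁ := 𝟙 _, τ₂ := 𝟙 _, τ₃ := kernel.ι E.c }
    exact (ShortComplex.exact_iff_of_epi_of_isIso_of_mono φ).2 E.exact₁

lemma shortExact_right : E.right.ShortExact where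
  mono_f := inferInstanceAs (Mono (kernel.ι _))
  epi_g := E.epi_c
  exact := ShortComplex.exact_of_f_is_kernel _ (kernelIsKernel _)

end FourTerm

end FourTerm

variable {R : Type u} [CommRing R]

@[simp]
lemma toCycles_cyclesMap {C D : Cochains R} (f : C ⟶ D) (i j : ℤ) :
    C.toCycles i j ≫ HomologicalComplex.cyclesMap f j = f.f i ≫ D.toCycles i j := by
  simp [← cancel_mono (D.iCycles j)]

/-! ### The two four-term sequences and their comparison -/

section Resolution

variable {S : ShortComplex (ModuleCat.{u} R)} (hS : S.ShortExact)

/-- The map induced on `Hom(H^n(C^*), -)` by a homomorphism of coefficients. -/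
abbrev homHMap {G G' : ModuleCat.{u} R} (f : G ⟶ G') (n : ℤ) : homH G n ⟶ homH G' n :=
  Functor.whiskerLeft _ ((linearYoneda R (ModuleCat.{u} R)).map f)

/-- The connecting homomorphism `Hom(H^n(C^*), G'') → Ext¹(H^n(C^*), G)`, natural in `C^*`. -/
def connectingH (n : ℤ) : homH S.X₃ n ⟶ extH S.X₁ n where
  app C := ModuleCat.ofHom (connecting hS (C.unop.homology n))
  naturality C D f := by
    ext b
    exact connecting_naturality hS _ _

/-- The exact sequence `0 → Hom(H^n, G) → Hom(H^n, G') → Hom(H^n, G'') → Ext¹(H^n, G) → 0`. -/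
def extSequence [Injective S.X₂] (n : ℤ) : FourTerm ((Cochains R)ᵒᵖ ⥤ ModuleCat.{u} R) where
  a := homHMap S.f n
  b := homHMap S.g n
  c := connectingH hS n
  a_b := by
    ext C (φ : C.unop.homology n ⟶ S.X₁)
    change (φ ≫ S.f) ≫ S.g = 0
    simp
  b_c := by
    ext C (φ : C.unop.homology n ⟶ S.X₂)
    change connecting hS _ (φ ≫ S.g) = 0
    rw [connecting_apply, ← Abelian.Ext.mk₀_comp_mk₀_assoc, hS.comp_extClass,
      Abelian.Ext.comp_zero]
  mono_a := by
    have := hS.mono_f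
    have (C : (Cochains R)ᵒᵖ) : Mono ((homHMap S.f n).app C) := by
      rw [ModuleCat.mono_iff_injective]
      intro (φ : C.unop.homology n ⟶ S.X₁) (ψ : C.unop.homology n ⟶ S.X₁) h
      exact (cancel_mono S.f).1 h
    exact NatTrans.mono_of_mono_app _
  exact₁ := exact_of_evaluation _ fun C => (ShortComplex.moduleCat_exact_iff _).2
    fun (φ : C.unop.homology n ⟶ S.X₂) hφ => by
      have := hS.mono_f
      exact ⟨hS.exact.lift φ hφ, hS.exact.lift_f φ hφ⟩
  exact₂ := exact_of_evaluation _ fun C => (ShortComplex.moduleCat_exact_iff _).2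
    fun (φ : C.unop.homology n ⟶ S.X₃) hφ => exists_of_connecting_eq_zero hS _ φ hφ
  epi_c := by
    have (C : (Cochains R)ᵒᵖ) : Epi ((connectingH hS n).app C) := by
      rw [ModuleCat.epi_iff_surjective]
      exact connecting_surjective hS (C.unop.homology n)
    exact NatTrans.epi_of_epi_app _

variable (S) in
/-- The functor `C^* ↦ Hom(Z^n(C^*), G')`. -/
abbrev homZ (n : ℤ) : (Cochains R)ᵒᵖ ⥤ ModuleCat.{u} R :=
  (HomologicalComplex.cyclesFunctor (ModuleCat.{u} R) (ComplexShape.up ℤ) n).op ⋙ homInto S.X₂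

variable (S) in
/-- The module of pairs `(φ', φ'')` in `Hom(C^n, G') ⊕ Hom(Z^(n+1), G'')` with `φ' ∘ δ = 0` and
`β ∘ φ' = φ'' ∘ δ`. -/
def truncCycles (C : Cochains R) (n : ℤ) :
    Submodule R ((C.X n ⟶ S.X₂) × (C.cycles (n + 1) ⟶ S.X₃)) where
  carrier := {φ | C.d (n - 1) n ≫ φ.1 = 0 ∧ φ.1 ≫ S.g = C.toCycles n (n + 1) ≫ φ.2}
  add_mem' {φ ψ} h h' := by
    refine ⟨?_, ?_⟩
    · simp [Preadditive.comp_add, h.1, h'.1]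
    · simp [Preadditive.comp_add, Preadditive.add_comp, h.2, h'.2]
  zero_mem' := by simp
  smul_mem' r φ h := by
    refine ⟨?_, ?_⟩
    · simp [h.1]
    · simp [h.2]

variable (S) in
/-- The contravariant functor `C^* ↦ truncCycles S C^* n`. -/
def truncCyclesFunctor (n : ℤ) : (Cochains R)ᵒᵖ ⥤ ModuleCat.{u} R where
  obj C := ModuleCat.of R (truncCycles S C.unop n)
  map {C D} f := ModuleCat.ofHom <| LinearMap.restrict
    (LinearMap.prodMap (Linear.leftComp R S.X₂ (f.unop.f n))
      (Linear.leftComp R S.X₃ (HomologicalComplex.cyclesMap f.unop (n + 1)))) (by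
    rintro (φ : (C.unop.X n ⟶ S.X₂) × (C.unop.cycles (n + 1) ⟶ S.X₃)) ⟨h₁, h₂⟩
    refine ⟨?_, ?_⟩
    · change D.unop.d (n - 1) n ≫ f.unop.f n ≫ φ.1 = 0
      rw [← f.unop.comm_assoc, h₁, comp_zero]
    · change (f.unop.f n ≫ φ.1) ≫ S.g =
        D.unop.toCycles n (n + 1) ≫ HomologicalComplex.cyclesMap f.unop (n + 1) ≫ φ.2
      rw [Category.assoc, h₂, reassoc_of% toCycles_cyclesMap f.unop n (n + 1)])
  map_id C := by
    refine ModuleCat.hom_ext (LinearMap.ext fun (x : truncCycles S C.unop n) =>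
      Subtype.ext (Prod.ext ?_ ?_))
    · change (𝟙 C.unop : C.unop ⟶ C.unop).f n ≫ x.1.1 = x.1.1
      simp
    · change HomologicalComplex.cyclesMap (𝟙 C.unop) (n + 1) ≫ x.1.2 = x.1.2
      simp
  map_comp {C D E} f g := by
    refine ModuleCat.hom_ext (LinearMap.ext fun (x : truncCycles S C.unop n) =>
      Subtype.ext (Prod.ext ?_ ?_))
    · change (g.unop ≫ f.unop).f n ≫ x.1.1 = g.unop.f n ≫ f.unop.f n ≫ x.1.1
      simp
    · change HomologicalComplex.cyclesMap (g.unop ≫ f.unop) (n + 1) ≫ x.1.2 =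
        HomologicalComplex.cyclesMap g.unop (n + 1) ≫
          HomologicalComplex.cyclesMap f.unop (n + 1) ≫ x.1.2
      rw [HomologicalComplex.cyclesMap_comp, Category.assoc]

lemma exists_homologyπ_comp {C : Cochains R} {n : ℤ} {A : ModuleCat.{u} R}
    {φ : C.cycles (n + 1) ⟶ A} (h : C.toCycles n (n + 1) ≫ φ = 0) :
    ∃ χ : C.homology (n + 1) ⟶ A, C.homologyπ (n + 1) ≫ χ = φ :=
  ⟨(C.homologyIsCokernel n (n + 1) (by simp)).desc (CokernelCofork.ofπ φ h),
    Cofork.IsColimit.π_desc (C.homologyIsCokernel n (n + 1) (by simp))⟩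

lemma truncCycles_d_extension {C : Cochains R} {n : ℤ} [Injective S.X₃] (q : truncCycles S C n) :
    (q.1.1, Injective.factorThru q.1.2 (C.iCycles (n + 1))) ∈ coneCycles S C n := by
  refine LinearMap.mem_ker.2 (Prod.ext q.2.1 (sub_eq_zero.2 ?_))
  have := Injective.comp_factorThru q.1.2 (C.iCycles (n + 1))
  change q.1.1 ≫ S.g = C.d n (n + 1) ≫ Injective.factorThru q.1.2 (C.iCycles (n + 1))
  rw [q.2.2, ← C.toCycles_i, Category.assoc, this]

section

variable [Injective S.X₃]

/-- The class in `H̄_n` of a pair `(φ', φ'')`, where `φ''` is extended from `Z^(n+1)` to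
`C^(n+1)`. -/
def truncClassFun {C : Cochains R} {n : ℤ} (q : truncCycles S C n) : coneHomology S C n :=
  coneClass S C n ⟨_, truncCycles_d_extension q⟩

/-- Two extensions of `φ''` differ by a map vanishing on cocycles, and such a map gives a boundary
of the cone. Linearity and naturality of the class follow from this independence. -/
lemma truncClassFun_eq {C : Cochains R} {n : ℤ} (q : truncCycles S C n) (z : coneCycles S C n)
    (h₁ : z.1.1 = q.1.1) (h₂ : C.iCycles (n + 1) ≫ z.1.2 = q.1.2) :
    truncClassFun q = coneClass S C n z := by
  refine (coneClass_eq_iff _ _).2 ?_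
  have h := mem_coneBoundaries_of_iCycles (S := S) (C := C) (n := n)
    (Injective.factorThru q.1.2 (C.iCycles (n + 1)) - z.1.2)
    (by rw [Preadditive.comp_sub, Injective.comp_factorThru, h₂, sub_self])
  convert h using 1
  exact Prod.ext (sub_eq_zero.2 h₁.symm) rfl

lemma exists_truncClassFun {C : Cochains R} {n : ℤ} (q : truncCycles S C n) :
    ∃ z : coneCycles S C n, z.1.1 = q.1.1 ∧ C.iCycles (n + 1) ≫ z.1.2 = q.1.2 ∧
      truncClassFun q = coneClass S C n z :=
  ⟨⟨_, truncCycles_d_extension q⟩, rfl, Injective.comp_factorThru _ _, rfl⟩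

variable (S) in
/-- The homomorphism `truncCycles S C^* n → H̄_n(C^*; G)`. -/
def truncClass (C : Cochains R) (n : ℤ) : truncCycles S C n →ₗ[R] coneHomology S C n where
  toFun := truncClassFun
  map_add' q q' := by
    obtain ⟨z, h₁, h₂, h₃⟩ := exists_truncClassFun q
    obtain ⟨z', h₁', h₂', h₃'⟩ := exists_truncClassFun q'
    rw [h₃, h₃', ← map_add]
    refine truncClassFun_eq _ _ ?_ ?_
    · simp [h₁, h₁']
    · simp [Preadditive.comp_add, h₂, h₂']
  map_smul' r q := by
    obtain ⟨z, h₁, h₂, h₃⟩ := exists_truncClassFun q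
    rw [h₃, RingHom.id_apply, ← map_smul]
    refine truncClassFun_eq _ _ ?_ ?_
    · simp [h₁]
    · simp [h₂]

variable (S) in
/-- The natural homomorphism `truncCycles S C^* n → H̄_n(C^*; G)`. -/
def truncClassNat (n : ℤ) : truncCyclesFunctor S n ⟶ Hbar S n where
  app C := ModuleCat.ofHom (truncClass S C.unop n)
  naturality C D f := by
    ext q
    obtain ⟨z, h₁, h₂, h₃⟩ := exists_truncClassFun q
    change truncClassFun _ = coneHomologyMap S f.unop n (truncClassFun q)
    rw [h₃, coneHomologyMap_class]
    refine truncClassFun_eq _ _ ?_ ?_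
    · change f.unop.f n ≫ z.1.1 = f.unop.f n ≫ q.1.1
      rw [h₁]
    · change D.unop.iCycles (n + 1) ≫ f.unop.f (n + 1) ≫ z.1.2 =
        HomologicalComplex.cyclesMap f.unop (n + 1) ≫ q.1.2
      rw [← h₂, HomologicalComplex.cyclesMap_i_assoc]

end

variable (S) in
/-- The homomorphism `φ ↦ (φ ∘ δ, β ∘ φ)` from `Hom(Z^(n+1), G')`. -/
def truncBoundaryApp (C : Cochains R) (n : ℤ) :
    (C.cycles (n + 1) ⟶ S.X₂) →ₗ[R] truncCycles S C n :=
  LinearMap.codRestrict _ (LinearMap.prod (Linear.leftComp R S.X₂ (C.toCycles n (n + 1)))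
    (Linear.rightComp R _ S.g)) fun φ => ⟨by simp, by simp⟩

/-- If `(φ', φ'')` is the boundary of `(ψ', ψ'')`, the term `ψ'' ∘ δ` disappears on cocycles, so
only the restriction of `ψ'` to `Z^(n+1)` matters. -/
lemma exists_truncBoundaryApp [Injective S.X₃] {C : Cochains R} {n : ℤ} (q : truncCycles S C n)
    (hq : truncClassFun q = 0) : ∃ φ, truncBoundaryApp S C n φ = q := by
  obtain ⟨z, h₁, h₂, h₃⟩ := exists_truncClassFun q
  obtain ⟨ψ, hψ⟩ := (Submodule.Quotient.mk_eq_zero _).1 (h₃.symm.trans hq)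
  refine ⟨C.iCycles (n + 1) ≫ ψ.1, Subtype.ext (Prod.ext ?_ ?_)⟩
  · change C.toCycles n (n + 1) ≫ C.iCycles (n + 1) ≫ ψ.1 = q.1.1
    rw [← h₁, HomologicalComplex.toCycles_i_assoc]
    exact congr_arg Prod.fst hψ
  · change (C.iCycles (n + 1) ≫ ψ.1) ≫ S.g = q.1.2
    have : ψ.1 ≫ S.g - C.d (n + 1) (n + 2) ≫ ψ.2 = z.1.2 := congr_arg Prod.snd hψ
    rw [← h₂, ← this]
    simp [Preadditive.comp_sub]

lemma truncClassFun_truncBoundaryApp [Injective S.X₂] [Injective S.X₃] {C : Cochains R} {n : ℤ}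
    (φ : C.cycles (n + 1) ⟶ S.X₂) : truncClassFun (truncBoundaryApp S C n φ) = 0 := by
  -- Injectivity of `G'` extends `φ` to `C^(n+1)`, where `(ψ, 0)` bounds the given pair.
  let ψ := Injective.factorThru φ (C.iCycles (n + 1))
  have hψ : C.iCycles (n + 1) ≫ ψ = φ := Injective.comp_factorThru _ _
  refine (truncClassFun_eq _ ⟨boundary S C n (n + 1) (n + 2) (ψ, 0),
    LinearMap.mem_ker.2 (boundary_boundary _ _ _ _ _ _ _)⟩ ?_ ?_).trans ?_
  · change C.d n (n + 1) ≫ ψ = C.toCycles n (n + 1) ≫ φ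
    rw [← hψ, HomologicalComplex.toCycles_i_assoc]
  · change C.iCycles (n + 1) ≫ (ψ ≫ S.g - C.d (n + 1) (n + 2) ≫ 0) = φ ≫ S.g
    rw [comp_zero, sub_zero, reassoc_of% hψ]
  · exact (Submodule.Quotient.mk_eq_zero _).2 ⟨_, rfl⟩

-- From `β ∘ φ = 0` the map `φ` takes values in `G`; from `φ ∘ δ = 0` it descends to homology.
include hS in
lemma exists_of_truncBoundaryApp_eq_zero {C : Cochains R} {n : ℤ}
    (φ : C.cycles (n + 1) ⟶ S.X₂) (hφ : truncBoundaryApp S C n φ = 0) :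
    ∃ χ : C.homology (n + 1) ⟶ S.X₁, -(C.homologyπ (n + 1) ≫ χ ≫ S.f) = φ := by
  have := hS.mono_f
  have h₁ : C.toCycles n (n + 1) ≫ φ = 0 := congr_arg (fun q => q.1.1) hφ
  have h₂ : φ ≫ S.g = 0 := congr_arg (fun q => q.1.2) hφ
  have hψ : hS.exact.lift φ h₂ ≫ S.f = φ := hS.exact.lift_f φ h₂
  generalize hS.exact.lift φ h₂ = ψ at hψ
  have hz : C.toCycles n (n + 1) ≫ ψ = 0 := by
    rw [← cancel_mono S.f, Category.assoc, hψ, h₁, zero_comp]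
  obtain ⟨χ, hχ⟩ := exists_homologyπ_comp hz
  exact ⟨-χ, by simp [reassoc_of% hχ, hψ]⟩

variable (S) in
/-- The homomorphism `φ ↦ (φ ∘ δ, β ∘ φ)` from `Hom(Z^(n+1), G')`, natural in `C^*`. -/
def truncBoundary (n : ℤ) : homZ S (n + 1) ⟶ truncCyclesFunctor S n where
  app C := ModuleCat.ofHom (truncBoundaryApp S C.unop n)
  naturality C D f := by
    ext (φ : C.unop.cycles (n + 1) ⟶ S.X₂)
    refine Subtype.ext (Prod.ext ?_ ?_)
    · change D.unop.toCycles n (n + 1) ≫ HomologicalComplex.cyclesMap f.unop (n + 1) ≫ φ =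
        f.unop.f n ≫ C.unop.toCycles n (n + 1) ≫ φ
      rw [reassoc_of% toCycles_cyclesMap f.unop n (n + 1)]
    · change (HomologicalComplex.cyclesMap f.unop (n + 1) ≫ φ) ≫ S.g =
        HomologicalComplex.cyclesMap f.unop (n + 1) ≫ φ ≫ S.g
      simp

variable (S) in
/-- The homomorphism `Hom(H^(n+1), G) → Hom(Z^(n+1), G')`, `φ ↦ -α ∘ φ ∘ π`. -/
def homHToHomZ (n : ℤ) : homH S.X₁ n ⟶ homZ S n where
  app C := ModuleCat.ofHom
    (-(Linear.leftComp R S.X₂ (C.unop.homologyπ n) ∘ₗ Linear.rightComp R _ S.f))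
  naturality C D f := by
    ext (φ : C.unop.homology n ⟶ S.X₁)
    change -(D.unop.homologyπ n ≫ (HomologicalComplex.homologyMap f.unop n ≫ φ) ≫ S.f) =
      HomologicalComplex.cyclesMap f.unop n ≫ (-(C.unop.homologyπ n ≫ φ ≫ S.f))
    simp

/-- The exact sequence
`0 → Hom(H^(n+1), G) → Hom(Z^(n+1), G') → truncCycles n → H̄_n → 0`. -/
def coneSequence [Injective S.X₂] [Injective S.X₃] (n : ℤ) :
    FourTerm ((Cochains R)ᵒᵖ ⥤ ModuleCat.{u} R) where
  a := homHToHomZ S (n + 1)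
  b := truncBoundary S n
  c := truncClassNat S n
  a_b := by
    ext C (φ : C.unop.homology (n + 1) ⟶ S.X₁)
    refine Subtype.ext (Prod.ext ?_ ?_)
    · change C.unop.toCycles n (n + 1) ≫ (-(C.unop.homologyπ (n + 1) ≫ φ ≫ S.f)) = 0
      simp
    · change (-(C.unop.homologyπ (n + 1) ≫ φ ≫ S.f)) ≫ S.g = 0
      simp
  b_c := by
    ext C φ
    exact truncClassFun_truncBoundaryApp (C := C.unop) φ
  mono_a := by
    have := hS.mono_f
    have (C : (Cochains R)ᵒᵖ) : Mono ((homHToHomZ S (n + 1)).app C) := by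
      rw [ModuleCat.mono_iff_injective]
      intro (φ : C.unop.homology (n + 1) ⟶ S.X₁) (ψ : C.unop.homology (n + 1) ⟶ S.X₁) h
      exact (cancel_mono S.f).1 ((cancel_epi (C.unop.homologyπ (n + 1))).1 (neg_injective h))
    exact NatTrans.mono_of_mono_app _
  exact₁ := exact_of_evaluation _ fun C => (ShortComplex.moduleCat_exact_iff _).2
    fun φ hφ => exists_of_truncBoundaryApp_eq_zero hS (C := C.unop) φ hφ
  exact₂ := exact_of_evaluation _ fun C => (ShortComplex.moduleCat_exact_iff _).2
    fun q hq => exists_truncBoundaryApp (C := C.unop) q hq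
  epi_c := by
    have (C : (Cochains R)ᵒᵖ) : Epi ((truncClassNat S n).app C) := by
      rw [ModuleCat.epi_iff_surjective]
      intro x
      obtain ⟨z, rfl⟩ := Submodule.mkQ_surjective _ x
      refine ⟨(⟨(z.1.1, C.unop.iCycles (n + 1) ≫ z.1.2), coneCycles_fst z, ?_⟩ :
        truncCycles S C.unop n), truncClassFun_eq _ z rfl rfl⟩
      change z.1.1 ≫ S.g = C.unop.toCycles n (n + 1) ≫ C.unop.iCycles (n + 1) ≫ z.1.2
      rw [coneCycles_snd, HomologicalComplex.toCycles_i_assoc]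
    exact NatTrans.epi_of_epi_app _

variable (S) in
/-- The homomorphism `φ ↦ -φ ∘ π` from `Hom(H^(n+1), G')` to `Hom(Z^(n+1), G')`. -/
def homHToHomZ₁ (n : ℤ) : homH S.X₂ n ⟶ homZ S n where
  app C := ModuleCat.ofHom (-Linear.leftComp R S.X₂ (C.unop.homologyπ n))
  naturality C D f := by
    ext (φ : C.unop.homology n ⟶ S.X₂)
    change -(D.unop.homologyπ n ≫ HomologicalComplex.homologyMap f.unop n ≫ φ) =
      HomologicalComplex.cyclesMap f.unop n ≫ (-(C.unop.homologyπ n ≫ φ))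
    simp

variable (S) in
/-- The homomorphism `φ ↦ (0, -φ ∘ π)` from `Hom(H^(n+1), G'')` to `truncCycles n`. -/
def homHToTruncApp (C : Cochains R) (n : ℤ) :
    (C.homology (n + 1) ⟶ S.X₃) →ₗ[R] truncCycles S C n :=
  LinearMap.codRestrict _
    (LinearMap.prod 0 (-Linear.leftComp R S.X₃ (C.homologyπ (n + 1)))) fun φ => ⟨by simp, by simp⟩

variable (S) in
/-- The homomorphism `φ ↦ (0, -φ ∘ π)` from `Hom(H^(n+1), G'')` to `truncCycles n`, natural in
`C^*`. -/
def homHToTrunc (n : ℤ) : homH S.X₃ (n + 1) ⟶ truncCyclesFunctor S n where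
  app C := ModuleCat.ofHom (homHToTruncApp S C.unop n)
  naturality C D f := by
    ext (φ : C.unop.homology (n + 1) ⟶ S.X₃)
    refine Subtype.ext (Prod.ext ?_ ?_)
    · change 0 = f.unop.f n ≫ 0
      simp
    · change -(D.unop.homologyπ (n + 1) ≫ HomologicalComplex.homologyMap f.unop (n + 1) ≫ φ) =
        HomologicalComplex.cyclesMap f.unop (n + 1) ≫ (-(C.unop.homologyπ (n + 1) ≫ φ))
      simp

/-- This and the next two lemmas are the squares of the morphism between the sequences. The sign in
`χ̄`, carried leftwards through the vertical maps, is absorbed in `homHToHomZ`, so that the leftmost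
vertical map is the identity. -/
lemma extSequence_coneSequence₀ (n : ℤ) :
    homHMap S.f n ≫ homHToHomZ₁ S n = homHToHomZ S n := rfl

lemma extSequence_coneSequence₁ (n : ℤ) :
    homHMap S.g (n + 1) ≫ homHToTrunc S n = homHToHomZ₁ S (n + 1) ≫ truncBoundary S n := by
  ext C (φ : C.unop.homology (n + 1) ⟶ S.X₂)
  refine Subtype.ext (Prod.ext ?_ ?_)
  · change 0 = C.unop.toCycles n (n + 1) ≫ (-(C.unop.homologyπ (n + 1) ≫ φ))
    simp
  · change -(C.unop.homologyπ (n + 1) ≫ φ ≫ S.g) = (-(C.unop.homologyπ (n + 1) ≫ φ)) ≫ S.g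
    simp

lemma extSequence_coneSequence₂ [Injective S.X₂] [Injective S.X₃] (n : ℤ) :
    connectingH hS (n + 1) ≫ chiBar hS n = homHToTrunc S n ≫ truncClassNat S n := by
  ext C (φ : C.unop.homology (n + 1) ⟶ S.X₃)
  change chiBarApp hS C.unop n (connecting hS _ φ) = truncClassFun _
  rw [chiBarApp_connecting]
  obtain ⟨z, h₁, h₂, h₃⟩ := exists_truncClassFun ((homHToTrunc S n).app C φ)
  exact (chi_eq φ z h₁ h₂).trans h₃.symm

end Resolution

/-! ### The universal coefficient sequence of a single complex -/

section UniversalCoefficients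

/-- A homomorphism to an injective module that vanishes on cocycles factors through `δ`. -/
lemma exists_d_comp {C : Cochains R} {n m : ℤ} (hm : (ComplexShape.up ℤ).next n = m)
    {I : ModuleCat.{u} R} [Injective I] {φ : C.X n ⟶ I} (h : C.iCycles n ≫ φ = 0) :
    ∃ ψ : C.X m ⟶ I, C.d n m ≫ ψ = φ := by
  let T : ShortComplex (ModuleCat.{u} R) := ShortComplex.mk (C.iCycles n) (C.d n m) (by simp)
  have hT : T.Exact := T.exact_of_f_is_kernel (C.cyclesIsKernel n m hm)
  exact ⟨hT.descToInjective φ h, hT.comp_descToInjective φ h⟩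

variable {S : ShortComplex (ModuleCat.{u} R)} (hS : S.ShortExact) [Injective S.X₂]
  [Injective S.X₃]

/-- If `(0, -φ'')` bounds `(ψ', ψ'')`, then `ψ'` kills coboundaries and induces `χ` on `H^(n+1)`. On
cocycles `ψ'' ∘ δ` vanishes, so `b = -β ∘ χ` lifts to `G'` and its connecting image is zero. -/
theorem chiBarApp_injective (C : Cochains R) (n : ℤ) :
    Function.Injective (chiBarApp hS C n) := by
  rw [injective_iff_map_eq_zero]
  intro x hx
  obtain ⟨b, rfl⟩ := connecting_surjective hS _ x
  rw [chiBarApp_connecting] at hx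
  obtain ⟨ψ, hψ⟩ := (Submodule.Quotient.mk_eq_zero _).1 hx
  have h₁ : C.d n (n + 1) ≫ ψ.1 = 0 := congr($hψ.1)
  have h₂ : ψ.1 ≫ S.g - C.d (n + 1) (n + 2) ≫ ψ.2 = -extension b := congr($hψ.2)
  have hz : C.toCycles n (n + 1) ≫ C.iCycles (n + 1) ≫ ψ.1 = 0 := by
    rw [HomologicalComplex.toCycles_i_assoc, h₁]
  obtain ⟨χ, hχ⟩ := exists_homologyπ_comp hz
  have hb : b = (-χ) ≫ S.g := by
    rw [← cancel_epi (C.homologyπ (n + 1)), ← extension_spec, ← neg_neg (extension b), ← h₂]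
    simp [Preadditive.comp_sub, reassoc_of% hχ]
  rw [hb, connecting_apply, ← Abelian.Ext.mk₀_comp_mk₀_assoc, hS.comp_extClass,
    Abelian.Ext.comp_zero]

theorem exists_chiBarApp (C : Cochains R) (n : ℤ) (x : coneHomology S C n)
    (hx : xiBarApp hS C n x = 0) : ∃ y, chiBarApp hS C n y = x := by
  obtain ⟨z, rfl⟩ := Submodule.mkQ_surjective _ x
  have hz : C.iCycles n ≫ z.1.1 = 0 := by
    have : xiFun hS z = 0 := hx
    rw [← xiFun_spec hS z, this, zero_comp, comp_zero]
  -- Subtracting the boundary of `(ψ, 0)` makes the first component zero; the second then vanishes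
  -- on coboundaries and defines `-b` on `H^(n+1)`.
  obtain ⟨ψ, hψ⟩ := exists_d_comp (m := n + 1) (by simp) hz
  have h : C.toCycles n (n + 1) ≫ C.iCycles (n + 1) ≫ (ψ ≫ S.g - z.1.2) = 0 := by
    rw [HomologicalComplex.toCycles_i_assoc, Preadditive.comp_sub, reassoc_of% hψ, coneCycles_snd,
      sub_self]
  obtain ⟨b, hb⟩ := exists_homologyπ_comp h
  refine ⟨connecting hS _ b, ?_⟩
  rw [chiBarApp_connecting, chi_eq b
    ⟨z.1 - boundary S C n (n + 1) (n + 2) (ψ, 0),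
      sub_mem z.2 (LinearMap.mem_ker.2 (boundary_boundary _ _ _ _ _ _ _))⟩ ?_ ?_]
  · refine (coneClass_eq_iff _ _).2 ⟨-(ψ, 0), ?_⟩
    rw [map_neg]
    exact (sub_sub_cancel_left _ _).symm
  · change z.1.1 - C.d n (n + 1) ≫ ψ = 0
    rw [hψ, sub_self]
  · change C.iCycles (n + 1) ≫ (z.1.2 - (ψ ≫ S.g - C.d (n + 1) (n + 2) ≫ 0)) = _
    rw [hb, comp_zero, sub_zero, ← Preadditive.comp_neg, neg_sub]

theorem xiBarApp_surjective (C : Cochains R) (n : ℤ) :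
    Function.Surjective (xiBarApp hS C n) := by
  intro φ
  -- Extend `α ∘ φ` from `H^n` to `C^n / B^n`. Since `β ∘ α = 0`, the map `β ∘ a` vanishes on
  -- cocycles and so factors through `δ`; this factor is the second component of the cycle.
  let a : C.opcycles n ⟶ S.X₂ := Injective.factorThru (φ ≫ S.f) (C.homologyι n)
  have ha : C.homologyι n ≫ a = φ ≫ S.f := Injective.comp_factorThru _ _
  have hc : C.iCycles n ≫ C.pOpcycles n ≫ a ≫ S.g = 0 := by
    rw [← HomologicalComplex.homology_π_ι_assoc, reassoc_of% ha]
    simp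
  obtain ⟨ψ, hψ⟩ := exists_d_comp (m := n + 1) (by simp) hc
  refine ⟨coneClass S C n ⟨(C.pOpcycles n ≫ a, ψ), LinearMap.mem_ker.2 (Prod.ext ?_ ?_)⟩,
    xiFun_unique hS _ φ ?_⟩
  · change C.d (n - 1) n ≫ C.pOpcycles n ≫ a = 0
    simp
  · change (C.pOpcycles n ≫ a) ≫ S.g - C.d n (n + 1) ≫ ψ = 0
    rw [hψ, Category.assoc, sub_self]
  · change _ = C.iCycles n ≫ C.pOpcycles n ≫ a
    rw [← HomologicalComplex.homology_π_ι_assoc, ha]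

/-- The universal coefficient sequence, as a short complex of functors of `C^*`. -/
abbrev ucfSequence (n : ℤ) : ShortComplex ((Cochains R)ᵒᵖ ⥤ ModuleCat.{u} R) :=
  ShortComplex.mk (chiBar hS n) (xiBar hS n) (chiBar_xiBar hS n)

theorem shortExact_ucfSequence (n : ℤ) : (ucfSequence hS n).ShortExact :=
  shortExact_of_evaluation _ fun C => ModuleCat.shortComplex_shortExact _
    ((ShortComplex.ShortExact.moduleCat_exact_iff_function_exact _).1
      ((ShortComplex.moduleCat_exact_iff _).2 fun x hx => exists_chiBarApp hS C.unop n x hx))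
    (chiBarApp_injective hS C.unop n) (xiBarApp_surjective hS C.unop n)

end UniversalCoefficients

/-! ### Yoneda products with the class of a four-term sequence -/

section ExtClass

universe v w

variable {A : Type w} [Category.{v} A] [Abelian A] [HasExt.{v} A]

lemma comp_extClass_bijective {S : ShortComplex A} (hS : S.ShortExact) (X : A) (i : ℕ)
    (h : ∀ (j : ℕ) (x : Abelian.Ext.{v} X S.X₂ (j + 1)), x = 0) :
    Function.Bijective fun x : Abelian.Ext.{v} X S.X₃ (i + 1) => x.comp hS.extClass rfl := by
  refine ⟨fun x y hxy => ?_, fun x => ?_⟩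
  · have h0 : (x - y).comp hS.extClass rfl = 0 := by
      rw [sub_eq_add_neg, Abelian.Ext.add_comp, Abelian.Ext.neg_comp]
      exact (sub_eq_add_neg _ _).symm.trans (sub_eq_zero.2 hxy)
    obtain ⟨z, hz⟩ := Abelian.Ext.covariant_sequence_exact₃ _ hS _ rfl h0
    rw [h i z, Abelian.Ext.zero_comp] at hz
    exact sub_eq_zero.1 hz.symm
  · exact Abelian.Ext.covariant_sequence_exact₁ _ hS x (h (i + 1) _) rfl

namespace FourTerm

/-- The class in `Ext²(X₃, X₀)` of an exact sequence `0 → X₀ → X₁ → X₂ → X₃ → 0`. -/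
def extClass (E : FourTerm A) : Abelian.Ext.{v} E.X₃ E.X₀ 2 :=
  E.shortExact_right.extClass.comp E.shortExact_left.extClass rfl

/-- The morphism restricts to the two short exact halves, with the same induced map on `ker c`;
naturality of their classes is then composed. -/
lemma extClass_naturality (E E' : FourTerm A) (f₀ : E.X₀ ⟶ E'.X₀) (f₁ : E.X₁ ⟶ E'.X₁)
    (f₂ : E.X₂ ⟶ E'.X₂) (f₃ : E.X₃ ⟶ E'.X₃) (h₀ : f₀ ≫ E'.a = E.a ≫ f₁)
    (h₁ : f₁ ≫ E'.b = E.b ≫ f₂) (h₂ : f₂ ≫ E'.c = E.c ≫ f₃) :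
    E.extClass.comp (Abelian.Ext.mk₀ f₀) (add_zero 2) =
      (Abelian.Ext.mk₀ f₃).comp E'.extClass (zero_add 2) := by
  let l : E.left ⟶ E'.left :=
    { τ₁ := f₀
      τ₂ := f₁
      τ₃ := kernel.map _ _ f₂ f₃ h₂.symm
      comm₁₂ := h₀
      comm₂₃ := by simp [← cancel_mono (kernel.ι E'.c), h₁] }
  let r : E.right ⟶ E'.right :=
    { τ₁ := kernel.map _ _ f₂ f₃ h₂.symm
      τ₂ := f₂
      τ₃ := f₃
      comm₁₂ := by simp
      comm₂₃ := h₂ }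
  have hl := ShortComplex.ShortExact.extClass_naturality E.shortExact_left E'.shortExact_left l
  have hr := ShortComplex.ShortExact.extClass_naturality E.shortExact_right E'.shortExact_right r
  rw [extClass, extClass, Abelian.Ext.comp_assoc_of_third_deg_zero]
  refine (congr_arg (fun y => E.shortExact_right.extClass.comp y rfl) hl).trans ?_
  rw [← Abelian.Ext.comp_assoc_of_second_deg_zero]
  refine (congr_arg (fun y => y.comp E'.shortExact_left.extClass rfl) hr).trans ?_
  exact Abelian.Ext.comp_assoc _ _ _ _ _ (by simp)

lemma comp_extClass_naturality (E E' : FourTerm A) (f₀ : E.X₀ ⟶ E'.X₀) (f₁ : E.X₁ ⟶ E'.X₁)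
    (f₂ : E.X₂ ⟶ E'.X₂) (f₃ : E.X₃ ⟶ E'.X₃) (h₀ : f₀ ≫ E'.a = E.a ≫ f₁)
    (h₁ : f₁ ≫ E'.b = E.b ≫ f₂) (h₂ : f₂ ≫ E'.c = E.c ≫ f₃) {X : A} {i : ℕ}
    (x : Abelian.Ext.{v} X E.X₃ i) :
    (x.comp (Abelian.Ext.mk₀ f₃) (add_zero i)).comp E'.extClass rfl =
      (x.comp E.extClass rfl).comp (Abelian.Ext.mk₀ f₀) (add_zero (i + 2)) := by
  rw [Abelian.Ext.comp_assoc_of_third_deg_zero, Abelian.Ext.comp_assoc_of_second_deg_zero,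
    extClass_naturality E E' f₀ f₁ f₂ f₃ h₀ h₁ h₂]

/-- The product splits into two connecting homomorphisms, through `ker c`, each bijective because
the middle term of its half is acyclic. -/
lemma comp_extClass_bijective (E : FourTerm A) (X : A) (i : ℕ)
    (h₁ : ∀ (j : ℕ) (x : Abelian.Ext.{v} X E.X₁ (j + 1)), x = 0)
    (h₂ : ∀ (j : ℕ) (x : Abelian.Ext.{v} X E.X₂ (j + 1)), x = 0) :
    Function.Bijective fun x : Abelian.Ext.{v} X E.X₃ (i + 1) => x.comp E.extClass rfl := by
  have := (UCF.comp_extClass_bijective E.shortExact_left X (i + 1) h₁).comp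
    (UCF.comp_extClass_bijective E.shortExact_right X i h₂)
  convert this using 2 with x
  exact (Abelian.Ext.comp_assoc _ _ _ _ _ (by lia)).symm

/-- The exact sequence of functors obtained by composition with a functor. -/
@[simps]
def whisker {J K B : Type*} [Category* J] [Category* K] [Category* B] [Abelian B]
    (E : FourTerm (J ⥤ B)) (F : K ⥤ J) : FourTerm (K ⥤ B) where
  a := Functor.whiskerLeft F E.a
  b := Functor.whiskerLeft F E.b
  c := Functor.whiskerLeft F E.c
  a_b := by rw [← Functor.whiskerLeft_comp, E.a_b]; rfl
  b_c := by rw [← Functor.whiskerLeft_comp, E.b_c]; rfl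
  mono_a := by
    have := E.mono_a
    have (k : K) : Mono ((Functor.whiskerLeft F E.a).app k) :=
      inferInstanceAs (Mono (E.a.app (F.obj k)))
    exact NatTrans.mono_of_mono_app _
  exact₁ := exact_of_evaluation _ fun k => E.exact₁.map ((evaluation J B).obj (F.obj k))
  exact₂ := exact_of_evaluation _ fun k => E.exact₂.map ((evaluation J B).obj (F.obj k))
  epi_c := by
    have := E.epi_c
    have (k : K) : Epi ((Functor.whiskerLeft F E.c).app k) :=
      inferInstanceAs (Epi (E.c.app (F.obj k)))
    exact NatTrans.epi_of_epi_app _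

end FourTerm

instance preservesZeroMorphisms_extFunctor {R : Type u} [CommRing R] [Linear R A] (X : A) (i : ℕ) :
    (extFunctor R X i).PreservesZeroMorphisms where
  map_zero F G := by
    refine ModuleCat.hom_ext (LinearMap.ext fun x => ?_)
    exact (congr_arg (fun y => Abelian.Ext.comp x y (add_zero i)) (Abelian.Ext.mk₀_zero F G)).trans
      (Abelian.Ext.comp_zero _ _ _ _ _)

end ExtClass

/-! ### The natural retraction and the sequence of derived limits -/

section Systems

variable {R : Type u} [CommRing R] (Γ : Type u) [Preorder Γ] (i : ℕ)

/-- The contravariant functor sending a direct system `{C^*_γ}` to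
`Ext^i(R, {F(C^*_γ)})`. -/
abbrev extSystem (F : (Cochains R)ᵒᵖ ⥤ ModuleCat.{u} R) :
    (Γ ⥤ Cochains R)ᵒᵖ ⥤ ModuleCat.{u} R :=
  Functor.opHom Γ (Cochains R) ⋙ (Functor.whiskeringRight _ _ _).obj F ⋙
    extFunctor R (unitSystem R Γ) i

/-- The natural transformation induced by `F ⟶ F'`. -/
abbrev extSystemMap {F F' : (Cochains R)ᵒᵖ ⥤ ModuleCat.{u} R} (t : F ⟶ F') :
    extSystem Γ i F ⟶ extSystem Γ i F' :=
  Functor.whiskerLeft (Functor.opHom Γ (Cochains R))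
    (Functor.whiskerRight ((Functor.whiskeringRight Γᵒᵖ _ _).map t)
      (extFunctor R (unitSystem R Γ) i))

/-- The isomorphism `lim^(i) {F(C^*_γ)} ≅ Ext^i(R, {F(C^*_γ)})`. -/
def limDSystemIso (F : (Cochains R)ᵒᵖ ⥤ ModuleCat.{u} R) : limDSystem Γ i F ≅ extSystem Γ i F :=
  Functor.isoWhiskerLeft (Functor.opHom Γ (Cochains R))
    (Functor.isoWhiskerLeft ((Functor.whiskeringRight _ _ _).obj F) (limDIso R Γ i))

lemma limDSystemIso_naturality {F F' : (Cochains R)ᵒᵖ ⥤ ModuleCat.{u} R} (t : F ⟶ F') :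
    limDSystemMap Γ i t ≫ (limDSystemIso Γ i F').hom =
      (limDSystemIso Γ i F).hom ≫ extSystemMap Γ i t := by
  ext1
  ext1 C
  exact (limDIso R Γ i).hom.naturality _

/-- The iterated connecting homomorphism of an exact sequence `0 → X₀ → X₁ → X₂ → X₃ → 0`. -/
def connectingSystem (E : FourTerm ((Cochains R)ᵒᵖ ⥤ ModuleCat.{u} R)) :
    extSystem Γ i E.X₃ ⟶ extSystem Γ (i + 2) E.X₀ where
  app C := ModuleCat.ofHom
    (Abelian.Ext.postcompOfLinear (E.whisker C.unop.op).extClass R (unitSystem R Γ) rfl)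
  naturality C D f := by
    ext (x : Abelian.Ext.{u} (unitSystem R Γ) (C.unop.op ⋙ E.X₃) i)
    exact (E.whisker C.unop.op).comp_extClass_naturality (E.whisker D.unop.op)
      (Functor.whiskerRight (NatTrans.op f.unop) E.X₀)
      (Functor.whiskerRight (NatTrans.op f.unop) E.X₁)
      (Functor.whiskerRight (NatTrans.op f.unop) E.X₂)
      (Functor.whiskerRight (NatTrans.op f.unop) E.X₃)
      (by ext1; ext1 γ; exact E.a.naturality _) (by ext1; ext1 γ; exact E.b.naturality _)
      (by ext1; ext1 γ; exact E.c.naturality _) x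

lemma connectingSystem_naturality (E E' : FourTerm ((Cochains R)ᵒᵖ ⥤ ModuleCat.{u} R))
    (f₀ : E.X₀ ⟶ E'.X₀) (f₁ : E.X₁ ⟶ E'.X₁)
    (f₂ : E.X₂ ⟶ E'.X₂) (f₃ : E.X₃ ⟶ E'.X₃) (h₀ : f₀ ≫ E'.a = E.a ≫ f₁)
    (h₁ : f₁ ≫ E'.b = E.b ≫ f₂) (h₂ : f₂ ≫ E'.c = E.c ≫ f₃) :
    connectingSystem Γ i E ≫ extSystemMap Γ (i + 2) f₀ =
      extSystemMap Γ i f₃ ≫ connectingSystem Γ i E' := by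
  ext1
  ext1 C
  ext (x : Abelian.Ext.{u} (unitSystem R Γ) (C.unop.op ⋙ E.X₃) i)
  exact ((E.whisker C.unop.op).comp_extClass_naturality (E'.whisker C.unop.op)
    (Functor.whiskerLeft _ f₀) (Functor.whiskerLeft _ f₁) (Functor.whiskerLeft _ f₂)
    (Functor.whiskerLeft _ f₃) (by ext1; ext1 γ; exact congr(($h₀).app _))
    (by ext1; ext1 γ; exact congr(($h₁).app _)) (by ext1; ext1 γ; exact congr(($h₂).app _))
    x).symm

variable {S : ShortComplex (ModuleCat.{u} R)} (hS : S.ShortExact) [Injective S.X₂]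
  [Injective S.X₃]

/-- Naturality of the connecting homomorphism for the morphism of four-term sequences with identity
at the left end. Only exactness of the second sequence is needed, not acyclicity of its middle
terms. -/
lemma extSystemMap_chiBar_connectingSystem (n : ℤ) :
    extSystemMap Γ i (chiBar hS n) ≫ connectingSystem Γ i (coneSequence hS n) =
      connectingSystem Γ i (extSequence hS (n + 1)) := by
  have h := connectingSystem_naturality Γ i (extSequence hS (n + 1)) (coneSequence hS n)
    (𝟙 _) (homHToHomZ₁ S (n + 1)) (homHToTrunc S n) (chiBar hS n)
    ((Category.id_comp _).trans (extSequence_coneSequence₀ (n + 1)).symm)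
    (extSequence_coneSequence₁ n).symm (extSequence_coneSequence₂ hS n).symm
  have h' : extSystemMap Γ (i + 2) (𝟙 (homH S.X₁ (n + 1))) = 𝟙 _ := by
    ext1
    ext1 C
    exact (extFunctor R (unitSystem R Γ) (i + 2)).map_id _
  exact h.symm.trans ((congr_arg _ h').trans (Category.comp_id _))

variable [IsDirectedOrder Γ] [Nonempty Γ]

/-- The middle terms are dual systems of `{H^n(C^*_γ)}` with values in the injectives `G'` and
`G''`, hence acyclic. The degree `i + 1` is essential: in degree `0` the middle terms have nonzero
limits. -/
lemma isIso_connectingSystem_extSequence (n : ℤ) :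
    IsIso (connectingSystem Γ (i + 1) (extSequence hS n)) := by
  have (C : (Γ ⥤ Cochains R)ᵒᵖ) :
      IsIso ((connectingSystem Γ (i + 1) (extSequence hS n)).app C) := by
    rw [ConcreteCategory.isIso_iff_bijective]
    let A : Γ ⥤ ModuleCat.{u} R :=
      C.unop ⋙ HomologicalComplex.homologyFunctor (ModuleCat.{u} R) (ComplexShape.up ℤ) n
    exact ((extSequence hS n).whisker C.unop.op).comp_extClass_bijective (unitSystem R Γ) i
      (fun j x => ext_dualSystem_eq_zero S.X₂ j A x)
      (fun j x => ext_dualSystem_eq_zero S.X₃ j A x)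
  exact NatIso.isIso_of_isIso_app _

/-- For `i ≥ 1` the homomorphism induced by `χ̄` has a natural left inverse. -/
theorem exists_retraction_extSystemMap (n : ℤ) :
    ∃ r, extSystemMap Γ (i + 1) (chiBar hS n) ≫ r = 𝟙 _ := by
  have := isIso_connectingSystem_extSequence Γ i hS (n + 1)
  refine ⟨connectingSystem Γ (i + 1) (coneSequence hS n) ≫
    @inv _ _ _ _ (connectingSystem Γ (i + 1) (extSequence hS (n + 1))) this, ?_⟩
  exact (Category.assoc _ _ _).symm.trans
    ((congr_arg (· ≫ _) (extSystemMap_chiBar_connectingSystem Γ (i + 1) hS n)).trans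
      (@IsIso.hom_inv_id _ _ _ _ _ this))

lemma extSystemMap_chiBar_injective (n : ℤ) (C : Γ ⥤ Cochains R)
    (x : Abelian.Ext.{u} (unitSystem R Γ) (C.op ⋙ extH S.X₁ (n + 1)) i)
    (hx : x.comp (Abelian.Ext.mk₀ (Functor.whiskerLeft C.op (chiBar hS n))) (add_zero i) = 0) :
    x = 0 := by
  obtain _ | i := i
  -- No retraction is available in degree `0`, where left exactness of `Hom(R, -)` suffices.
  · have := (shortExact_whiskeringLeft (shortExact_ucfSequence hS n) C.op).mono_f
    have : Mono (Functor.whiskerLeft C.op (chiBar hS n)) := this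
    exact Abelian.Ext.postcomp_mk₀_injective_of_mono _ _ 
      (hx.trans (map_zero _).symm)
  · obtain ⟨r, hr⟩ := exists_retraction_extSystemMap Γ i hS n
    have h : r.app (op C) ((extSystemMap Γ (i + 1) (chiBar hS n)).app (op C) x) = x :=
      congr(($hr).app (op C) x)
    have h' : (extSystemMap Γ (i + 1) (chiBar hS n)).app (op C) x = 0 := hx
    rw [h', map_zero] at h
    exact h.symm

theorem shortExact_extFunctor (n : ℤ) (C : Γ ⥤ Cochains R) :
    (ShortComplex.mk ((extSystemMap Γ i (chiBar hS n)).app (op C))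
      ((extSystemMap Γ i (xiBar hS n)).app (op C)) (by
        have : (extFunctor R (unitSystem R Γ) i).map
            (Functor.whiskerLeft C.op (chiBar hS n ≫ xiBar hS n)) = 0 := by
          rw [chiBar_xiBar]
          exact (extFunctor R (unitSystem R Γ) i).map_zero _ _
        rw [Functor.whiskerLeft_comp, Functor.map_comp] at this
        exact this)).ShortExact := by
  have hU := shortExact_whiskeringLeft (shortExact_ucfSequence hS n) C.op
  refine ModuleCat.shortComplex_shortExact _
    ((ShortComplex.ShortExact.moduleCat_exact_iff_function_exact _).1
      ((ShortComplex.moduleCat_exact_iff _).2 ?_)) ?_ ?_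
  · exact Abelian.Ext.covariant_sequence_exact₂ _ hU
  · exact (injective_iff_map_eq_zero _).2 (extSystemMap_chiBar_injective Γ i hS n C)
  · intro y
    refine Abelian.Ext.covariant_sequence_exact₃ _ hU y rfl ?_
    -- The obstruction to lifting `y` lies in degree `i + 1` of the `Ext` term and dies under `χ̄`,
    -- consecutive maps of the long exact sequence composing to zero; by injectivity in that degree
    -- it is zero.
    refine extSystemMap_chiBar_injective Γ (i + 1) hS n C _ ?_
    refine (Abelian.Ext.comp_assoc_of_third_deg_zero _ _ _ _).trans ?_
    exact (congr_arg (fun z => Abelian.Ext.comp y z rfl) hU.extClass_comp).trans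
      (Abelian.Ext.comp_zero _ _ _ _ _)

theorem shortExact_limSequence (n : ℤ) (C : Γ ⥤ Cochains R) :
    ((limSequence Γ i hS n).map ((evaluation _ _).obj (op C))).ShortExact :=
  ShortComplex.shortExact_of_iso
    (ShortComplex.isoMk ((limDSystemIso Γ i _).app (op C)) ((limDSystemIso Γ i _).app (op C))
      ((limDSystemIso Γ i _).app (op C))
      congr(($(limDSystemIso_naturality Γ i (chiBar hS n))).app (op C)).symm
      congr(($(limDSystemIso_naturality Γ i (xiBar hS n))).app (op C)).symm).symm
    (shortExact_extFunctor Γ i hS n C)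

/-- For `i ≥ 1` the sequence of `lim^(i)` splits naturally. -/
theorem nonempty_splitting_limSequence (n : ℤ) :
    Nonempty (limSequence Γ (i + 1) hS n).Splitting := by
  have hE : (limSequence Γ (i + 1) hS n).ShortExact :=
    shortExact_of_evaluation _ fun C => shortExact_limSequence Γ (i + 1) hS n C.unop
  obtain ⟨r, hr⟩ := exists_retraction_extSystemMap Γ i hS n
  have := hE.epi_g
  refine ⟨ShortComplex.Splitting.ofExactOfRetraction _ hE.exact
    ((limDSystemIso Γ (i + 1) _).hom ≫ r ≫ (limDSystemIso Γ (i + 1) _).inv) ?_ this⟩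
  have h : limDSystemMap Γ (i + 1) (chiBar hS n) ≫ (limDSystemIso Γ (i + 1) _).hom ≫ r ≫
      (limDSystemIso Γ (i + 1) _).inv = 𝟙 _ := by
    rw [reassoc_of% limDSystemIso_naturality Γ (i + 1) (chiBar hS n), reassoc_of% hr, Iso.hom_inv_id]
  exact h

end Systems
end UCF

end

theorem theorem3 {R : Type u} [CommRing R] [IsDomain R] [IsPrincipalIdealRing R]
    {S : ShortComplex (ModuleCat.{u} R)} (hS : S.ShortExact)
    [Injective S.X₂] [Injective S.X₃]
    (Γ : Type u) [Preorder Γ] [IsDirectedOrder Γ] [Nonempty Γ] (n : ℤ) (i : ℕ) :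
    (∀ C : Γ ⥤ UCF.Cochains R,
      ((UCF.limSequence Γ i hS n).map ((evaluation _ _).obj (op C))).ShortExact) ∧
    (1 ≤ i → Nonempty (UCF.limSequence Γ i hS n).Splitting) := by
  refine ⟨fun C => UCF.shortExact_limSequence Γ i hS n C, fun hi => ?_⟩
  obtain _ | i := i
  · lia
  · exact UCF.nonempty_splitting_limSequence Γ i hS n
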